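/- Let $\Bbbk$ be an algebraically closed field of characteristic $0$, let $n>2$ be an odd integer, $m=n^2$, let $\zeta\in\Bbbk$ be a primitive $m^2$-th root of unity, and put $\mathbf q=\zeta^{m}$ (a primitive $m$-th root of unity) and $q=\mathbf q^{\,n}$ (a primitive $n$-th root of unity). Let $H$ be the $\Bbbk$-algebra generated by $E,F,K,K^{-1}$ with relations $$KK^{-1}=K^{-1}K=1,\quad KEK^{-1}=q^2E,\quad KFK^{-1}=q^{-2}F,\quad EF-FE=\frac{K-K^{-1}}{q-q^{-1}},\quad E^n=F^n=0,\quad K^{n^2}=1$$ (the small quasi-quantum group $\widetilde U_q$ with $c=d=n$). Let $G=\langle K\rangle$, a cyclic group of order $m$; for $g=K^s$ with $0\le s<m$ let $\chi_g(K^r)=\mathbf q^{sr}$ and $1_g=\frac1m\sum_{h\in G}\chi_g(h)h$. For $0\le s,r<m$ put $\Phi_1(K^s,K^r)=\zeta^{\,nr(\overline{s-2n}-(s-2n))}$ and $\Phi_2(K^s,K^r)=\zeta^{\,nr(\overline{s+2n}-(s+2n))}$, where $\overline{x}\in\{0,\dots,m-1\}$ is the remainder of $x$ modulo $m$. The tensor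 product $M\otimes N=M\otimes_{\Bbbk}N$ of $H$-modules is an $H$-module through the algebra map $\Delta:H\to H\otimes H$ with $$\Delta(K)=K\otimes K,\quad \Delta(E)=\sum_{f,g\in G}\Phi_1(f,g)\,E1_f\otimes 1_g+K\otimes E,\quad \Delta(F)=\sum_{f,g\in G}\Phi_2(f,g)\chi_g(K)\,F1_f\otimes 1_g+1\otimes F .$$ For $1\le l\le n$ let $V_l$ be the simple $H$-module with basis $m_1,\dots,m_l$ and $Em_i=m_{i+1}$ ($m_{l+1}=0$), $Fm_1=0$, $Fm_i=\beta_{i-1}(l)\,m_{i-1}$ for $i>1$, $Km_i=q^{2i-l-1}m_i$, where $$\beta_i(l)=\frac{(1+q^2+\cdots+q^{2(i-1)})(1-q^{2(i-l)})}{q^{2i-l}-q^{2i-l-2}} .$$ Let $P_l$ be the projective cover of $V_l$ as an $H$-module, and let $P_0=0$. For $1\le t\le n-1$ and $r\in\mathbb Z$ let $\mathbf V(t,r)$ be the $H$-module with basis $v_1,\dots,v_n$ and $Ev_i=v_{i+1}$ ($v_{n+1}=0$), $Fv_1=0$, $Fv_i=\gamma_{i-1}v_{i-1}$ for $i>1$,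 $Kv_i=\mathbf q^{t}q^{2(r+i-1)}v_i$, where $$\gamma_j=\frac{1}{q-q^{-1}}\Big(\mathbf q^{-t}\,\frac{q^{-2r}-q^{-2(r+j)}}{1-q^{-2}}-\mathbf q^{t}\,\frac{q^{2r}-q^{2(r+j)}}{1-q^{2}}\Big).$$ **Theorem.** Let $1\le t,t'\le n-1$ with $t+t'=n$, let $r,r'\in\mathbb Z$, and let $0\le u\le n-1$ with $r+r'\equiv u \pmod n$. 1. If $0\le u\le\frac{n-1}{2}$, then $$\mathbf V(t,r)\otimes\mathbf V(t',r')\;\cong\;\Big(\bigoplus_{j=u}^{\frac{n-1}{2}}P_{2j}\Big)\oplus V_n\oplus\Big(\bigoplus_{1\le j\le u-1}P_{n-2u+2j}\Big).$$ 2. If $\frac{n+1}{2}\le u\le n-1$, then $$\mathbf V(t,r)\otimes\mathbf V(t',r')\;\cong\;\Big(\bigoplus_{n+1-u\le j\le\frac{n-1}{2}}P_{2j}\Big)\oplus\Big(\bigoplus_{j=0}^{n-u}P_{2u+2j-n}\Big).$$ Moreover, $P_0,P_1,\dots,P_n$ are projective and pairwise non-isomorphic, and $P_n\cong V_n$; hence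 the summands in each decomposition are projective and pairwise non-isomorphic. -/

import Mathlib

open scoped TensorProduct DirectSum

noncomputable section

namespace SmallQuasi

universe v

/-- The parameters of the small quasi-quantum group in the case `c = d = n`: an odd integer `n > 2`
and a primitive `m²`-th root of unity `ζ`, where `m = n d = n ^ 2`. -/
structure Datum (k : Type v) [Field k] where
  n : ℕ
  n_odd : Odd n
  two_lt : 2 < n
  ζ : k
  prim : IsPrimitiveRoot ζ ((n ^ 2) ^ 2)

namespace Datum
variable {k : Type v} [Field k] (S : Datum k)

/-- `m = n d = n ^ 2`, the order of the group `G = ⟨K⟩`. -/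
def m : ℕ := S.n ^ 2

/-- `ξ_m = ζ ^ m`, a primitive `m`-th root of unity (also denoted by a bold `q`). -/
def ξ : k := S.ζ ^ S.m

/-- `q = ξ_m ^ n`, a primitive `n`-th root of unity. -/
def q : k := S.ξ ^ S.n

theorem n_pos : 0 < S.n := by have := S.two_lt; omega
theorem m_pos : 0 < S.m := pow_pos S.n_pos 2
instance : NeZero S.m := ⟨S.m_pos.ne'⟩

theorem ξ_prim : IsPrimitiveRoot S.ξ S.m :=
  S.prim.pow (pow_pos (pow_pos S.n_pos 2) 2) (by simp [m, sq])

theorem q_prim : IsPrimitiveRoot S.q S.n :=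
  S.ξ_prim.pow S.m_pos (by simp [m, sq])

theorem ζ_ne : S.ζ ≠ 0 := S.prim.ne_zero (pow_pos (pow_pos S.n_pos 2) 2).ne'
theorem ξ_ne : S.ξ ≠ 0 := S.ξ_prim.ne_zero S.m_pos.ne'
theorem q_ne : S.q ≠ 0 := S.q_prim.ne_zero S.n_pos.ne'
theorem q_pow_n : S.q ^ S.n = 1 := S.q_prim.pow_eq_one

theorem q2_prim : IsPrimitiveRoot (S.q ^ 2) S.n :=
  S.q_prim.pow_of_coprime 2 (Nat.coprime_two_left.mpr S.n_odd)

theorem q2_ne_one : S.q ^ 2 ≠ 1 := S.q2_prim.ne_one (by have := S.two_lt; omega)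

theorem q_sub_inv_ne : S.q - S.q⁻¹ ≠ 0 := by
  intro h
  apply S.q2_ne_one
  have h' := sub_eq_zero.mp h
  rw [sq]; nth_rewrite 2 [h']
  exact mul_inv_cancel₀ S.q_ne

theorem m_cast_ne : (S.m : k) ≠ 0 := (S.ξ_prim.neZero').out

end Datum

/-- The four generators `E, F, K, K⁻¹`. -/
inductive Gen where
  | E | F | K | Kinv

section presentation
variable {k : Type v} [Field k] (S : Datum k)

/-- The elements `E, F, K, L` of an algebra satisfy the defining relations of the small
quasi-quantum group, with `L` in the role of `K⁻¹`. -/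
structure Relations {A : Type*} [Ring A] [Algebra k A] (E F K L : A) : Prop where
  KL : K * L = 1
  LK : L * K = 1
  KE : K * E * L = S.q ^ 2 • E
  KF : K * F * L = S.q ^ (-2 : ℤ) • F
  EF : E * F - F * E = (S.q - S.q⁻¹)⁻¹ • (K - L)
  En : E ^ S.n = 0
  Fn : F ^ S.n = 0
  Km : K ^ S.m = 1

open Gen FreeAlgebra in
/-- The defining relations on the free algebra: those of `U_q(sl₂)` together with
`E ^ n = 0`, `F ^ n = 0`, `K ^ (n ^ 2) = 1`. -/
inductive Rel : FreeAlgebra k Gen → FreeAlgebra k Gen → Prop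
  | KL : Rel (ι k K * ι k Kinv) 1
  | LK : Rel (ι k Kinv * ι k K) 1
  | KE : Rel (ι k K * ι k E * ι k Kinv) (S.q ^ 2 • ι k E)
  | KF : Rel (ι k K * ι k F * ι k Kinv) (S.q ^ (-2 : ℤ) • ι k F)
  | EF : Rel (ι k E * ι k F - ι k F * ι k E) ((S.q - S.q⁻¹)⁻¹ • (ι k K - ι k Kinv))
  | En : Rel (ι k E ^ S.n) 0
  | Fn : Rel (ι k F ^ S.n) 0
  | Km : Rel (ι k K ^ S.m) 1

/-- The underlying algebra of the small quasi-quantum group. -/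
def H : Type v := RingQuot (Rel S)

instance : Ring (H S) := inferInstanceAs (Ring (RingQuot (Rel S)))
instance : Algebra k (H S) := inferInstanceAs (Algebra k (RingQuot (Rel S)))

namespace H

/-- The quotient map. -/
def mk : FreeAlgebra k Gen →ₐ[k] H S := RingQuot.mkAlgHom k (Rel S)

theorem mk_rel {x y : FreeAlgebra k Gen} (h : Rel S x y) : mk S x = mk S y :=
  RingQuot.mkAlgHom_rel k h

/-- The image of a generator in the quotient. -/
def gen (g : Gen) : H S := mk S (FreeAlgebra.ι k g)

def E : H S := gen S Gen.E
def F : H S := gen S Gen.F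
def K : H S := gen S Gen.K
def Kinv : H S := gen S Gen.Kinv

theorem rels : Relations S (E S) (F S) (K S) (Kinv S) where
  KL := by simpa [E, F, K, Kinv, gen] using mk_rel S Rel.KL
  LK := by simpa [E, F, K, Kinv, gen] using mk_rel S Rel.LK
  KE := by simpa [E, F, K, Kinv, gen] using mk_rel S Rel.KE
  KF := by simpa [E, F, K, Kinv, gen] using mk_rel S Rel.KF
  EF := by simpa [E, F, K, Kinv, gen] using mk_rel S Rel.EF
  En := by simpa [E, F, K, Kinv, gen] using mk_rel S Rel.En
  Fn := by simpa [E, F, K, Kinv, gen] using mk_rel S Rel.Fn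
  Km := by simpa [E, F, K, Kinv, gen] using mk_rel S Rel.Km

variable {S} in
/-- The images of the generators. -/
def genMap {A : Type*} (E F K L : A) : Gen → A
  | Gen.E => E
  | Gen.F => F
  | Gen.K => K
  | Gen.Kinv => L

/-- The universal property of the presentation. -/
def lift {A : Type*} [Ring A] [Algebra k A] {E F K L : A} (h : Relations S E F K L) :
    H S →ₐ[k] A :=
  RingQuot.liftAlgHom k ⟨FreeAlgebra.lift k (genMap E F K L), by
    intro x y hxy
    cases hxy <;> simp only [map_mul, map_sub, map_smul, map_pow, map_one, map_zero,
      FreeAlgebra.lift_ι_apply, genMap]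
    exacts [h.KL, h.LK, h.KE, h.KF, h.EF, h.En, h.Fn, h.Km]⟩

theorem lift_gen {A : Type*} [Ring A] [Algebra k A] {E F K L : A} (h : Relations S E F K L)
    (g : Gen) : lift S h (gen S g) = genMap E F K L g := by
  unfold lift gen mk
  erw [RingQuot.liftAlgHom_mkAlgHom_apply]
  simp

theorem induction {C : H S → Prop} (hs : ∀ c : k, C (algebraMap k _ c))
    (hg : ∀ g, C (gen S g)) (hm : ∀ x y, C x → C y → C (x * y))
    (ha : ∀ x y, C x → C y → C (x + y)) (x : H S) : C x := by
  obtain ⟨y, rfl⟩ : ∃ y, mk S y = x := RingQuot.mkAlgHom_surjective k (Rel S) x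
  induction y using FreeAlgebra.induction with
  | grade0 r => simpa using hs r
  | grade1 g => exact hg g
  | mul a b iha ihb => simpa using hm _ _ iha ihb
  | add a b iha ihb => simpa using ha _ _ iha ihb

end H
end presentation
section finite
variable {k : Type v} [Field k] {S : Datum k}

namespace Relations
variable {A : Type*} [Ring A] [Algebra k A] {E F K L : A}

theorem KE' (h : Relations S E F K L) : K * E = S.q ^ 2 • (E * K) := by
  rw [← smul_mul_assoc, ← h.KE, mul_assoc, h.LK, mul_one]

theorem KF' (h : Relations S E F K L) : K * F = S.q ^ (-2 : ℤ) • (F * K) := by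
  rw [← smul_mul_assoc, ← h.KF, mul_assoc, h.LK, mul_one]

theorem L_eq (h : Relations S E F K L) : L = K ^ (S.m - 1) := by
  have h1 : K ^ S.m = K ^ (S.m - 1) * K := by
    rw [← pow_succ, Nat.sub_add_cancel S.m_pos]
  calc L = K ^ S.m * L := by rw [h.Km, one_mul]
    _ = _ := by rw [h1, mul_assoc, h.KL, mul_one]

theorem KE_pow (h : Relations S E F K L) (a : ℕ) : K * E ^ a = (S.q ^ 2) ^ a • (E ^ a * K) := by
  induction a with
  | zero => simp
  | succ a ih =>
    rw [pow_succ E, ← mul_assoc, ih, smul_mul_assoc, mul_assoc, h.KE', mul_smul_comm, smul_smul,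
      ← pow_succ, mul_assoc]

theorem KF_pow (h : Relations S E F K L) (a : ℕ) :
    K * F ^ a = (S.q ^ (-2 : ℤ)) ^ a • (F ^ a * K) := by
  induction a with
  | zero => simp
  | succ a ih =>
    rw [pow_succ F, ← mul_assoc, ih, smul_mul_assoc, mul_assoc, h.KF', mul_smul_comm, smul_smul,
      ← pow_succ, mul_assoc]

end Relations

namespace H
variable (S)

/-- The span of the monomials `E ^ a * F ^ b * K ^ c`. -/
def monoSpan : Submodule k (H S) :=
  Submodule.span k (Set.range fun x : ℕ × ℕ × ℕ => E S ^ x.1 * F S ^ x.2.1 * K S ^ x.2.2)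

theorem mono_mem (a b c : ℕ) : E S ^ a * F S ^ b * K S ^ c ∈ monoSpan S :=
  Submodule.subset_span ⟨(a, b, c), rfl⟩

theorem mul_mem_of {y : H S} (hy : ∀ a b c, y * (E S ^ a * F S ^ b * K S ^ c) ∈ monoSpan S)
    {x : H S} (hx : x ∈ monoSpan S) : y * x ∈ monoSpan S := by
  induction hx using Submodule.span_induction with
  | mem x h => obtain ⟨⟨a, b, c⟩, rfl⟩ := h; exact hy a b c
  | zero => simp
  | add x z _ _ h1 h2 => rw [mul_add]; exact add_mem h1 h2
  | smul c x _ h => rw [mul_smul_comm]; exact Submodule.smul_mem _ _ h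

theorem E_mul_mem {x : H S} (hx : x ∈ monoSpan S) : E S * x ∈ monoSpan S := by
  refine mul_mem_of S (fun a b c => ?_) hx
  rw [← mul_assoc, ← mul_assoc, ← pow_succ']
  exact mono_mem S _ _ _

theorem K_mul_mem {x : H S} (hx : x ∈ monoSpan S) : K S * x ∈ monoSpan S := by
  refine mul_mem_of S (fun a b c => ?_) hx
  rw [← mul_assoc, ← mul_assoc, (rels S).KE_pow, smul_mul_assoc, smul_mul_assoc, mul_assoc _ (K S),
    (rels S).KF_pow, mul_smul_comm, smul_mul_assoc, ← mul_assoc, mul_assoc _ (K S), ← pow_succ']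
  exact Submodule.smul_mem _ _ (Submodule.smul_mem _ _ (mono_mem S _ _ _))

theorem Kinv_mul_mem {x : H S} (hx : x ∈ monoSpan S) : Kinv S * x ∈ monoSpan S := by
  rw [(rels S).L_eq]
  generalize S.m - 1 = j
  induction j with
  | zero => simpa using hx
  | succ j ih => rw [pow_succ', mul_assoc]; exact K_mul_mem S ih

theorem F_mul_mem {x : H S} (hx : x ∈ monoSpan S) : F S * x ∈ monoSpan S := by
  refine mul_mem_of S (fun a b c => ?_) hx
  induction a with
  | zero =>
    have := mono_mem S 0 (b + 1) c
    simpa [pow_succ', mul_assoc] using this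
  | succ a ih =>
    have h : F S * E S = E S * F S - (S.q - S.q⁻¹)⁻¹ • (K S - Kinv S) := by
      rw [← (rels S).EF]; abel
    have h2 : F S * (E S ^ (a + 1) * F S ^ b * K S ^ c)
        = E S * (F S * (E S ^ a * F S ^ b * K S ^ c)) - (S.q - S.q⁻¹)⁻¹ •
          (K S * (E S ^ a * F S ^ b * K S ^ c) - Kinv S * (E S ^ a * F S ^ b * K S ^ c)) := by
      rw [pow_succ', ← sub_mul, ← smul_mul_assoc, ← mul_assoc, ← mul_assoc, ← mul_assoc, h]
      simp only [sub_mul, mul_assoc, smul_mul_assoc]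
    rw [h2]
    exact sub_mem (E_mul_mem S ih) (Submodule.smul_mem _ _
      (sub_mem (K_mul_mem S (mono_mem S _ _ _)) (Kinv_mul_mem S (mono_mem S _ _ _))))

theorem monoSpan_eq_top : monoSpan S = ⊤ := by
  have key : ∀ y : H S, ∀ x ∈ monoSpan S, y * x ∈ monoSpan S := by
    intro y
    induction y using induction with
    | hs c =>
      intro x hx
      rw [← Algebra.smul_def]
      exact Submodule.smul_mem _ _ hx
    | hg g =>
      intro x hx
      cases g
      exacts [E_mul_mem S hx, F_mul_mem S hx, K_mul_mem S hx, Kinv_mul_mem S hx]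
    | hm a b iha ihb => intro x hx; rw [mul_assoc]; exact iha _ (ihb _ hx)
    | ha a b iha ihb => intro x hx; rw [add_mul]; exact add_mem (iha _ hx) (ihb _ hx)
  rw [eq_top_iff]
  intro y _
  have := key y 1 (by simpa using mono_mem S 0 0 0)
  simpa using this

instance finiteDimensional : FiniteDimensional k (H S) := by
  have hfin : (Set.range fun x : ℕ × ℕ × ℕ =>
      E S ^ x.1 * F S ^ x.2.1 * K S ^ x.2.2).Finite := by
    refine Set.Finite.subset
      (((Finset.range S.n ×ˢ Finset.range S.n ×ˢ Finset.range S.m).finite_toSet.image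
        (fun x : ℕ × ℕ × ℕ => E S ^ x.1 * F S ^ x.2.1 * K S ^ x.2.2)).union
        (Set.finite_singleton 0)) ?_
    rintro _ ⟨⟨a, b, c⟩, rfl⟩
    by_cases ha : a < S.n
    · by_cases hb : b < S.n
      · left
        simp only [Set.mem_image, Finset.mem_coe, Finset.mem_product,
          Finset.mem_range]
        refine ⟨(a, b, c % S.m), ⟨ha, hb, Nat.mod_lt _ S.m_pos⟩, ?_⟩
        simp only
        rw [← pow_eq_pow_mod c (rels S).Km]
      · right
        simp [pow_eq_zero_of_le (not_lt.mp hb) (rels S).Fn]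
    · right
      simp [pow_eq_zero_of_le (not_lt.mp ha) (rels S).En]
  have h := Module.Finite.span_of_finite k hfin
  change Module.Finite k (monoSpan S) at h
  rw [monoSpan_eq_top] at h
  exact Module.Finite.equiv Submodule.topEquiv

instance : IsNoetherian (H S) (H S) := isNoetherian_of_tower k inferInstance
instance : IsArtinian (H S) (H S) := isArtinian_of_tower k inferInstance

end H
end finite

section cover

/-- `π : P → M` is a projective cover: `P` is projective, `π` is surjective, and the kernel of `π`
is superfluous in `P`. -/
structure IsProjectiveCover {A : Type*} [Ring A] {P M : Type*} [AddCommGroup P] [Module A P]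
    [AddCommGroup M] [Module A M] (π : P →ₗ[A] M) : Prop where
  projective : Module.Projective A P
  surjective : Function.Surjective π
  superfluous : ∀ N : Submodule A P, N ⊔ LinearMap.ker π = ⊤ → N = ⊤

theorem exists_projectiveCover (A : Type*) [Ring A] [IsNoetherian A A] [IsArtinian A A] (M : Type*) [AddCommGroup M] [Module A M] [Module.Finite A M] :
    ∃ (d : ℕ) (P : Submodule A (Fin d → A)) (π : P →ₗ[A] M), IsProjectiveCover π := by
  obtain ⟨d, f, hf⟩ := Module.Finite.exists_fin' A M
  have hne : {P : Submodule A (Fin d → A) | Module.Projective A P ∧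
      Function.Surjective (f.domRestrict P)}.Nonempty := by
    refine ⟨⊤, Module.Projective.of_equiv Submodule.topEquiv.symm, fun x => ?_⟩
    obtain ⟨y, hy⟩ := hf x
    exact ⟨⟨y, trivial⟩, hy⟩
  obtain ⟨P, ⟨hP, hs⟩, hmin⟩ := WellFounded.has_min
    (wellFounded_lt : WellFounded ((· < ·) : Submodule A (Fin d → A) → _ → Prop)) _ hne
  refine ⟨d, P, f.domRestrict P, hP, hs, ?_⟩
  intro N hN
  let π := f.domRestrict P
  have hNs : Function.Surjective (π.domRestrict N) := by
    intro x
    obtain ⟨y, hy⟩ := hs x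
    have : y ∈ N ⊔ LinearMap.ker π := hN ▸ Submodule.mem_top
    obtain ⟨a, ha, b, hb, rfl⟩ := Submodule.mem_sup.mp this
    refine ⟨⟨a, ha⟩, ?_⟩
    have hb' : π b = 0 := hb
    rw [map_add, hb', add_zero] at hy
    exact hy
  obtain ⟨g, hg⟩ := Module.projective_lifting_property (π.domRestrict N) π hNs
  let e : Module.End A P := N.subtype ∘ₗ g
  have he : ∀ x, π (e x) = π x := fun x => LinearMap.congr_fun hg x
  have hej : ∀ (j : ℕ) x, π ((e ^ j) x) = π x := by
    intro j
    induction j with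
    | zero => simp
    | succ j ih => intro x; rw [pow_succ', Module.End.mul_apply, he, ih]
  obtain ⟨j, hj1, hc⟩ := ((Filter.eventually_ge_atTop 1).and
    e.eventually_isCompl_ker_pow_range_pow).exists
  have hproj : Module.Projective A (LinearMap.range (e ^ j)) :=
    Module.Projective.of_split (LinearMap.range (e ^ j)).subtype
      ((LinearMap.range (e ^ j)).projectionOnto _ hc.symm) (by ext x; simp)
  set Q : Submodule A (Fin d → A) := (LinearMap.range (e ^ j)).map P.subtype with hQ
  have hQle : Q ≤ P := Submodule.map_subtype_le _ _
  have hQmem : Q ∈ {P : Submodule A (Fin d → A) | Module.Projective A P ∧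
      Function.Surjective (f.domRestrict P)} := by
    refine ⟨Module.Projective.of_equiv
      (Submodule.equivMapOfInjective P.subtype P.injective_subtype _), fun x => ?_⟩
    obtain ⟨y, rfl⟩ := hs x
    exact ⟨⟨((e ^ j) y : P), ⟨_, ⟨y, rfl⟩, rfl⟩⟩, hej j y⟩
  have hQP : Q = P := hQle.eq_of_not_lt (hmin Q hQmem)
  rw [eq_top_iff]
  rintro x -
  have hx : (x : Fin d → A) ∈ Q := by rw [hQP]; exact x.2
  obtain ⟨y, ⟨z, hz⟩, hy⟩ := hx
  have hyx : y = x := Subtype.ext hy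
  obtain ⟨i, rfl⟩ := Nat.exists_eq_add_of_le' hj1
  rw [← hyx, ← hz, pow_succ', Module.End.mul_apply]
  exact (g _).2

variable (A : Type*) [Ring A] [IsNoetherian A A] [IsArtinian A A] (M : Type*) [AddCommGroup M] [Module A M] [Module.Finite A M]

/-- A projective cover `P(M)` of `M` (unique up to isomorphism), realised as a submodule of a
finite free module. -/
def projCover :
    Submodule A (Fin (exists_projectiveCover A M).choose → A) :=
  (exists_projectiveCover A M).choose_spec.choose

/-- The covering map `P(M) → M`. -/
def projCoverMap : projCover A M →ₗ[A] M :=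
  (exists_projectiveCover A M).choose_spec.choose_spec.choose

theorem projCoverMap_isProjectiveCover : IsProjectiveCover (projCoverMap A M) :=
  (exists_projectiveCover A M).choose_spec.choose_spec.choose_spec

end cover

section modules
variable {k : Type v} [Field k] (S : Datum k)

/-- The basis vectors `w 0, …, w (l - 1)` of `k ^ l`, with `w i = 0` for `i ≥ l`. -/
def vec (k : Type v) [Field k] (l i : ℕ) : Fin l → k :=
  if h : i < l then Pi.single ⟨i, h⟩ 1 else 0

/-- The operator `w i ↦ w (i + 1)`. -/
def opE (k : Type v) [Field k] (l : ℕ) : Module.End k (Fin l → k) :=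
  (Pi.basisFun k (Fin l)).constr k fun i => vec k l (i + 1)

/-- The operator `w 0 ↦ 0`, `w i ↦ γ i • w (i - 1)` for `i ≥ 1`. -/
def opF (l : ℕ) (γ : ℕ → k) : Module.End k (Fin l → k) :=
  (Pi.basisFun k (Fin l)).constr k fun i => if (i : ℕ) = 0 then 0 else γ i • vec k l (i - 1)

/-- The operator `w i ↦ κ i • w i`. -/
def opK (l : ℕ) (κ : ℕ → k) : Module.End k (Fin l → k) :=
  (Pi.basisFun k (Fin l)).constr k fun i => κ i • vec k l i

theorem vec_of_lt {l : ℕ} (i : Fin l) : vec k l i = Pi.basisFun k (Fin l) i := by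
  simp [vec]

theorem vec_of_le {l i : ℕ} (h : l ≤ i) : vec k l i = 0 := by
  simp [vec, h]

theorem opE_vec (l i : ℕ) : opE k l (vec k l i) = vec k l (i + 1) := by
  by_cases h : i < l
  · have := vec_of_lt (k := k) ⟨i, h⟩
    simp only at this
    rw [this, opE, Module.Basis.constr_basis]
  · rw [vec_of_le (not_lt.mp h), vec_of_le (by omega), map_zero]

theorem opF_vec {l : ℕ} {γ : ℕ → k} (h0 : γ 0 = 0) (hl : γ l = 0) (i : ℕ) :
    opF l γ (vec k l i) = γ i • vec k l (i - 1) := by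
  by_cases h : i < l
  · have := vec_of_lt (k := k) ⟨i, h⟩
    simp only at this
    rw [this, opF, Module.Basis.constr_basis]
    rcases Nat.eq_zero_or_pos i with rfl | hi
    · simp [h0]
    · simp [hi.ne']
  · rw [vec_of_le (not_lt.mp h), map_zero]
    rcases (not_lt.mp h).eq_or_lt with rfl | h'
    · simp [hl]
    · rw [vec_of_le (i := i - 1) (by omega), smul_zero]

theorem opK_vec (l : ℕ) (κ : ℕ → k) (i : ℕ) :
    opK l κ (vec k l i) = κ i • vec k l i := by
  by_cases h : i < l
  · have := vec_of_lt (k := k) ⟨i, h⟩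
    simp only at this
    rw [this, opK, Module.Basis.constr_basis, this]
  · rw [vec_of_le (not_lt.mp h), map_zero, smul_zero]

theorem end_ext {l : ℕ} {f g : Module.End k (Fin l → k)}
    (h : ∀ i, i < l → f (vec k l i) = g (vec k l i)) : f = g := by
  refine (Pi.basisFun k (Fin l)).ext fun i => ?_
  rw [← vec_of_lt]
  exact h i i.2

/-- Sufficient conditions for the three operators to define a module. -/
theorem op_relations {l : ℕ} {κ γ : ℕ → k} (hl : l ≤ S.n) (hκ : ∀ i, κ i ≠ 0)
    (hκs : ∀ i, κ (i + 1) = S.q ^ 2 * κ i) (hκm : ∀ i, κ i ^ S.m = 1)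
    (h0 : γ 0 = 0) (hγl : γ l = 0)
    (hγ : ∀ i, i < l → γ i - γ (i + 1) = (S.q - S.q⁻¹)⁻¹ * (κ i - (κ i)⁻¹)) :
    Relations S (opE k l) (opF l γ) (opK l κ) (opK l fun i => (κ i)⁻¹) where
  KL := end_ext fun i _ => by simp [opK_vec, hκ]
  LK := end_ext fun i _ => by simp [opK_vec, hκ]
  KE := end_ext fun i _ => by
    simp only [Module.End.mul_apply, opK_vec, opE_vec, map_smul, LinearMap.smul_apply, smul_smul,
      hκs]
    congr 1
    field_simp [hκ i]
  KF := end_ext fun i _ => by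
    simp only [Module.End.mul_apply, opK_vec, opF_vec h0 hγl, map_smul, LinearMap.smul_apply,
      smul_smul]
    rcases i with _ | i
    · simp [h0]
    · congr 1
      have h1 := hκ i
      have h2 := S.q_ne
      rw [hκs, Nat.add_sub_cancel, zpow_neg]
      norm_cast
      field_simp
  EF := end_ext fun i hi => by
    simp only [Module.End.mul_apply, opK_vec, opF_vec h0 hγl, opE_vec, map_smul,
      LinearMap.smul_apply, LinearMap.sub_apply, Nat.add_sub_cancel]
    have : γ i • vec k l (i - 1 + 1) = γ i • vec k l i := by
      rcases i with _ | i
      · simp [h0]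
      · simp
    rw [this, ← sub_smul, hγ i hi, ← sub_smul, smul_smul]
  En := end_ext fun i _ => by
    have : ∀ j, (opE k l ^ j) (vec k l i) = vec k l (i + j) := by
      intro j
      induction j with
      | zero => simp
      | succ j ih => rw [pow_succ', Module.End.mul_apply, ih, opE_vec, add_assoc]
    rw [this, vec_of_le (by omega), LinearMap.zero_apply]
  Fn := end_ext fun i hi => by
    have : ∀ j i, i < j → (opF l γ ^ j) (vec k l i) = 0 := by
      intro j
      induction j with
      | zero => intro i h; omega
      | succ j ih =>
        intro i h
        rw [pow_succ, Module.End.mul_apply, opF_vec h0 hγl, map_smul]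
        rcases i with _ | i
        · simp [h0]
        · rw [ih _ (by omega), smul_zero]
    rw [this _ _ (by omega), LinearMap.zero_apply]
  Km := end_ext fun i _ => by
    have : ∀ j, (opK l κ ^ j) (vec k l i) = κ i ^ j • vec k l i := by
      intro j
      induction j with
      | zero => simp
      | succ j ih =>
        rw [pow_succ', Module.End.mul_apply, ih, map_smul, opK_vec, smul_smul, pow_succ]
    rw [this, hκm, one_smul, Module.End.one_apply]

/-- `α_i(l) = (i)_{q²} (1 - q ^ (2 (i - l)))`, where `(i)_{q²} = 1 + q² + ⋯ + q ^ (2 (i - 1))`. -/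
def α (l i : ℕ) : k :=
  (∑ j ∈ Finset.range i, (S.q ^ 2) ^ j) * (1 - S.q ^ (2 * ((i : ℤ) - l)))

/-- `β_i(l) = α_i(l) / (q ^ (2 i - l) - q ^ (2 i - l - 2))`. -/
def β (l i : ℕ) : k :=
  α S l i / (S.q ^ (2 * (i : ℤ) - l) - S.q ^ (2 * (i : ℤ) - l - 2))

/-- The `K`-eigenvalues of `V_l`: in zero-based indexing, `K w_i = q ^ (2 (i + 1) - l - 1) w_i`. -/
def simpleWt (l i : ℕ) : k := S.q ^ (2 * ((i : ℤ) + 1) - l - 1)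

theorem simple_rel (l : ℕ) (hl : l ≤ S.n) :
    Relations S (opE k l) (opF l (β S l)) (opK l (simpleWt S l))
      (opK l fun i => (simpleWt S l i)⁻¹) := by
  have hq := S.q_ne
  have hqn := S.q_pow_n
  have hq2 := sub_ne_zero.mpr S.q2_ne_one
  refine op_relations S hl (fun i => zpow_ne_zero _ hq) (fun i => ?_) (fun i => ?_) ?_ ?_ ?_
  · unfold simpleWt
    rw [← zpow_natCast, ← zpow_add₀ hq]
    congr 1; push_cast; ring
  · unfold simpleWt
    have : S.q ^ S.m = 1 := by rw [Datum.m, sq, pow_mul, hqn, one_pow]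
    rw [← zpow_natCast, ← zpow_mul, mul_comm, zpow_mul, zpow_natCast, this, one_zpow]
  · simp [β, α]
  · simp [β, α]
  · intro i _
    have hgeom : ∀ i : ℕ, (∑ j ∈ Finset.range i, (S.q ^ 2) ^ j)
        = ((S.q ^ 2) ^ i - 1) / (S.q ^ 2 - 1) := fun i => geom_sum_eq S.q2_ne_one i
    have hl0 : S.q ^ l ≠ 0 := pow_ne_zero _ hq
    have hi0 : S.q ^ i ≠ 0 := pow_ne_zero _ hq
    have e1 : ∀ i : ℕ, S.q ^ (2 * ((i : ℤ) - l)) = (S.q ^ i) ^ 2 / (S.q ^ l) ^ 2 := by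
      intro i
      rw [mul_comm, zpow_mul, zpow_sub₀ hq, zpow_natCast, zpow_natCast]
      norm_cast
      rw [div_pow]
    have e2 : ∀ i : ℕ, S.q ^ (2 * (i : ℤ) - l) = (S.q ^ i) ^ 2 / S.q ^ l := by
      intro i
      rw [zpow_sub₀ hq, mul_comm, zpow_mul, zpow_natCast, zpow_natCast]
      norm_cast
    have e3 : ∀ i : ℕ, S.q ^ (2 * (i : ℤ) - l - 2) = (S.q ^ i) ^ 2 / S.q ^ l / S.q ^ 2 := by
      intro i
      rw [zpow_sub₀ hq, e2]
      norm_cast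
    have e4 : S.q ^ (2 * ((i : ℤ) + 1) - l - 1) = (S.q ^ i) ^ 2 * S.q / S.q ^ l := by
      have : (2 * ((i : ℤ) + 1) - l - 1) = (2 * (i : ℤ) - l) + 1 := by ring
      rw [this, zpow_add₀ hq, e2, zpow_one]
      ring
    have e5 : ∀ i : ℕ, β S l i = ((S.q ^ i) ^ 2 - 1) * ((S.q ^ l) ^ 2 - (S.q ^ i) ^ 2) * S.q ^ 2 /
        ((S.q ^ 2 - 1) ^ 2 * S.q ^ l * (S.q ^ i) ^ 2) := by
      intro i
      have hi0 : S.q ^ i ≠ 0 := pow_ne_zero _ hq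
      have h6 : (S.q ^ i) ^ 2 / S.q ^ l - (S.q ^ i) ^ 2 / S.q ^ l / S.q ^ 2
          = (S.q ^ i) ^ 2 * (S.q ^ 2 - 1) / (S.q ^ l * S.q ^ 2) := by
        field_simp
      rw [β, α, e1, e2, e3, hgeom, h6, ← pow_mul, mul_comm 2 i, pow_mul]
      field_simp
    have e7 : S.q - S.q⁻¹ = (S.q ^ 2 - 1) / S.q := by field_simp
    unfold simpleWt
    rw [e5, e5, e4, e7, pow_succ S.q i]
    field_simp
    ring

/-- `γ_j`, for the parameters `(t, r)`. -/
def γ (t : ℕ) (r : ℤ) (j : ℕ) : k :=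
  1 / (S.q - S.q⁻¹) *
    (S.ξ ^ (-(t : ℤ)) * ((S.q ^ (-2 * r) - S.q ^ (-2 * (r + j))) / (1 - S.q ^ (-2 : ℤ))) -
      S.ξ ^ t * ((S.q ^ (2 * r) - S.q ^ (2 * (r + j))) / (1 - S.q ^ 2)))

/-- The `K`-eigenvalues of `𝐕(t, r)`: in zero-based indexing,
`K w_i = ξ ^ t q ^ (2 (r + i)) w_i`. -/
def bigWt (t : ℕ) (r : ℤ) (i : ℕ) : k := S.ξ ^ t * S.q ^ (2 * (r + i))

theorem big_rel (t : ℕ) (r : ℤ) :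
    Relations S (opE k S.n) (opF S.n (γ S t r)) (opK S.n (bigWt S t r))
      (opK S.n fun i => (bigWt S t r i)⁻¹) := by
  have hq := S.q_ne
  have hξ := S.ξ_ne
  have hqn := S.q_pow_n
  have hq2 := sub_ne_zero.mpr S.q2_ne_one
  have hq2' := sub_ne_zero.mpr S.q2_ne_one.symm
  refine op_relations S le_rfl (fun i => mul_ne_zero (pow_ne_zero _ hξ) (zpow_ne_zero _ hq))
    (fun i => ?_) (fun i => ?_) ?_ ?_ ?_
  · unfold bigWt
    have : S.q ^ (2 * (r + ((i + 1 : ℕ) : ℤ))) = S.q ^ 2 * S.q ^ (2 * (r + i)) := by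
      rw [← zpow_natCast, ← zpow_add₀ hq]
      congr 1; push_cast; ring
    rw [this]; ring
  · unfold bigWt
    have : S.q ^ S.m = 1 := by rw [Datum.m, sq, pow_mul, hqn, one_pow]
    rw [mul_pow, ← zpow_natCast (S.q ^ _), ← zpow_mul, mul_comm _ (S.m : ℤ), zpow_mul,
      zpow_natCast, this, one_zpow, mul_one, ← pow_mul, mul_comm, pow_mul, S.ξ_prim.pow_eq_one, one_pow]
  · simp [γ]
  · have h1 : S.q ^ (-2 * (r + S.n)) = S.q ^ (-2 * r) := by
      have : -2 * (r + S.n) = -2 * r + S.n * (-2) := by ring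
      rw [this, zpow_add₀ hq, zpow_mul S.q S.n, zpow_natCast, hqn, one_zpow, mul_one]
    have h2 : S.q ^ (2 * (r + S.n)) = S.q ^ (2 * r) := by
      have : 2 * (r + S.n) = 2 * r + S.n * 2 := by ring
      rw [this, zpow_add₀ hq, zpow_mul S.q S.n, zpow_natCast, hqn, one_zpow, mul_one]
    simp only [γ, h1, h2]
    simp
  · intro i _
    have e7 : S.q - S.q⁻¹ = (S.q ^ 2 - 1) / S.q := by field_simp
    have e8 : 1 - S.q ^ (-2 : ℤ) = (S.q ^ 2 - 1) / S.q ^ 2 := by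
      rw [zpow_neg]; norm_cast; field_simp
    set x := S.q ^ (2 * r) with hx
    have hx0 : x ≠ 0 := zpow_ne_zero _ hq
    set y := S.q ^ i with hy
    have hy0 : y ≠ 0 := pow_ne_zero _ hq
    have f1 : ∀ i : ℕ, S.q ^ (2 * (r + i)) = x * (S.q ^ i) ^ 2 := by
      intro i
      rw [mul_add, zpow_add₀ hq, mul_comm 2 (i : ℤ), zpow_mul S.q i, zpow_natCast]
      norm_cast
    have f2 : ∀ s : ℤ, S.q ^ (-2 * s) = (S.q ^ (2 * s))⁻¹ := by
      intro s; rw [← zpow_neg]; congr 1; ring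
    simp only [γ, bigWt, f2, f1, e7, zpow_neg, zpow_natCast, ← hx, pow_succ S.q i, ← hy]
    have ht : S.ξ ^ t ≠ 0 := pow_ne_zero _ hξ
    generalize S.ξ ^ t = z at ht
    have e9 : 1 - S.q ^ 2 = -(S.q ^ 2 - 1) := by ring
    rw [e9]
    field_simp
    ring

/-- The trivial action (used only as a default value). -/
theorem triv_rel (M : Type*) [AddCommGroup M] [Module k M] :
    Relations S (0 : Module.End k M) 0 1 1 := by
  have := S.n_pos.ne'
  constructor <;> simp [this]

/-- The `l`-dimensional module `V_l`, for `0 ≤ l ≤ n`; here `V_0 = 0`, and `V_1, …, V_n` are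
simple, pairwise non-isomorphic. (For `l > n`, which is never used, the action is the trivial one.) -/
def simpleRep (l : ℕ) : H S →ₐ[k] Module.End k (Fin l → k) :=
  if hl : l ≤ S.n then H.lift S (simple_rel S l hl) else H.lift S (triv_rel S (Fin l → k))

/-- The action on `𝐕(t, r)`. -/
def bigRep (t : ℕ) (r : ℤ) : H S →ₐ[k] Module.End k (Fin S.n → k) :=
  H.lift S (big_rel S t r)

/-- The module `V_l`. -/
@[nolint unusedArguments]
def V (_S : Datum k) (l : ℕ) : Type v := Fin l → k

/-- The module `𝐕(t, r)`. -/
@[nolint unusedArguments]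
def VV (S : Datum k) (_t : ℕ) (_r : ℤ) : Type v := Fin S.n → k

instance (l : ℕ) : AddCommGroup (V S l) := inferInstanceAs (AddCommGroup (Fin l → k))
instance (l : ℕ) : Module k (V S l) := inferInstanceAs (Module k (Fin l → k))
instance (l : ℕ) : FiniteDimensional k (V S l) :=
  inferInstanceAs (FiniteDimensional k (Fin l → k))
instance (l : ℕ) : Module (H S) (V S l) :=
  Module.compHom (Fin l → k) (simpleRep S l).toRingHom

instance (t : ℕ) (r : ℤ) : AddCommGroup (VV S t r) :=
  inferInstanceAs (AddCommGroup (Fin S.n → k))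
instance (t : ℕ) (r : ℤ) : Module k (VV S t r) := inferInstanceAs (Module k (Fin S.n → k))
instance (t : ℕ) (r : ℤ) : FiniteDimensional k (VV S t r) :=
  inferInstanceAs (FiniteDimensional k (Fin S.n → k))
instance (t : ℕ) (r : ℤ) : Module (H S) (VV S t r) :=
  Module.compHom (Fin S.n → k) (bigRep S t r).toRingHom

theorem V_smul (l : ℕ) (x : H S) (v : V S l) : x • v = simpleRep S l x v := rfl
theorem VV_smul (t : ℕ) (r : ℤ) (x : H S) (v : VV S t r) : x • v = bigRep S t r x v := rfl

instance (l : ℕ) : IsScalarTower k (H S) (V S l) where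
  smul_assoc c x v := by
    rw [V_smul, V_smul, map_smul]; rfl

instance (t : ℕ) (r : ℤ) : IsScalarTower k (H S) (VV S t r) where
  smul_assoc c x v := by
    rw [VV_smul, VV_smul, map_smul]; rfl

instance (l : ℕ) : Module.Finite (H S) (V S l) := Module.Finite.of_restrictScalars_finite k _ _

/-- The projective cover `P_l = P(V_l)`. In particular `P_0 = 0`, and `P_n ≅ V_n` since `V_n` is
projective. -/
abbrev P (l : ℕ) : Type v := projCover (H S) (V S l)

end modules

section qbinomial
variable {k : Type v} [Field k]

/-- Gaussian binomial coefficients. -/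
def gauss (Q : k) : ℕ → ℕ → k
  | _, 0 => 1
  | 0, _ + 1 => 0
  | N + 1, j + 1 => gauss Q N j + Q ^ (j + 1) * gauss Q N (j + 1)

theorem gauss_zero (Q : k) (N : ℕ) : gauss Q N 0 = 1 := by cases N <;> rfl

theorem gauss_of_lt (Q : k) : ∀ N j, N < j → gauss Q N j = 0
  | 0, j + 1, _ => rfl
  | N + 1, j + 1, h => by
    rw [gauss, gauss_of_lt Q N j (by omega), gauss_of_lt Q N (j + 1) (by omega)]; simp

theorem gauss_self (Q : k) : ∀ N, gauss Q N N = 1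
  | 0 => rfl
  | N + 1 => by rw [gauss, gauss_self Q N, gauss_of_lt Q N (N + 1) (by omega)]; simp

theorem gauss_absorb (Q : k) (N : ℕ) : ∀ j,
    (1 - Q ^ (j + 1)) * gauss Q (N + 1) (j + 1) = (1 - Q ^ (N + 1)) * gauss Q N j := by
  induction N with
  | zero =>
    intro j
    rcases j with _ | j
    · simp [gauss]
    · simp [gauss]
  | succ N ih =>
    intro j
    rw [gauss]
    have h1 := ih j
    rcases j with _ | j
    · rw [gauss_zero] at *
      linear_combination Q ^ (0 + 1) * h1
    · have h2 := ih j
      have h3 : gauss Q (N + 1) (j + 1) = gauss Q N j + Q ^ (j + 1) * gauss Q N (j + 1) := rfl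
      linear_combination Q ^ (j + 1 + 1) * h1 + Q * h2 - Q * (1 - Q ^ (N + 1)) * h3

variable {A : Type*} [Ring A] [Algebra k A]

theorem mul_pow_comm {Q : k} {X Y : A} (h : Y * X = Q • (X * Y)) (j : ℕ) :
    Y * X ^ j = Q ^ j • (X ^ j * Y) := by
  induction j with
  | zero => simp
  | succ j ih =>
    rw [pow_succ X, ← mul_assoc, ih, smul_mul_assoc, mul_assoc, h, mul_smul_comm, smul_smul,
      ← pow_succ, mul_assoc]

theorem add_pow_gauss {Q : k} {X Y : A} (h : Y * X = Q • (X * Y)) (N : ℕ) :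
    (X + Y) ^ N = ∑ j ∈ Finset.range (N + 1), gauss Q N j • (X ^ j * Y ^ (N - j)) := by
  induction N with
  | zero => simp [gauss]
  | succ N ih =>
    rw [pow_succ', ih, add_mul, Finset.mul_sum, Finset.mul_sum, Finset.sum_range_succ' _ (N + 1)]
    have h1 : ∀ j, X * (gauss Q N j • (X ^ j * Y ^ (N - j)))
        = gauss Q N j • (X ^ (j + 1) * Y ^ (N - j)) := by
      intro j; rw [mul_smul_comm, ← mul_assoc, ← pow_succ']
    have h2 : ∀ j ∈ Finset.range (N + 1), Y * (gauss Q N j • (X ^ j * Y ^ (N - j)))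
        = (Q ^ j * gauss Q N j) • (X ^ j * Y ^ (N + 1 - j)) := by
      intro j hj
      have : N + 1 - j = (N - j) + 1 := by have := Finset.mem_range.mp hj; omega
      rw [mul_smul_comm, ← mul_assoc, mul_pow_comm h, this, pow_succ' Y, smul_mul_assoc, smul_smul,
        mul_assoc, mul_comm]
    have h3 : ∑ j ∈ Finset.range (N + 1), (Q ^ j * gauss Q N j) • (X ^ j * Y ^ (N + 1 - j))
        = ∑ j ∈ Finset.range (N + 1), (Q ^ (j + 1) * gauss Q N (j + 1)) •
          (X ^ (j + 1) * Y ^ (N - j)) + Y ^ (N + 1) := by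
      rw [Finset.sum_range_succ', Finset.sum_range_succ _ N, gauss_of_lt Q N (N + 1) (by omega)]
      simp [gauss_zero]
    rw [Finset.sum_congr rfl (fun j _ => h1 j), Finset.sum_congr rfl h2, h3, ← add_assoc,
      ← Finset.sum_add_distrib]
    congr 1
    · refine Finset.sum_congr rfl fun j _ => ?_
      rw [← add_smul, gauss, Nat.add_sub_add_right]
    · simp [gauss_zero]

theorem add_pow_root {Q : k} {n : ℕ} (hn : 0 < n) (hQ : IsPrimitiveRoot Q n) {X Y : A}
    (h : Y * X = Q • (X * Y)) : (X + Y) ^ n = X ^ n + Y ^ n := by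
  obtain ⟨N, rfl⟩ := Nat.exists_eq_add_of_le' hn
  rw [add_pow_gauss h, Finset.sum_range_succ, Finset.sum_range_succ', gauss_self, gauss_zero]
  have : ∑ j ∈ Finset.range N, gauss Q (N + 1) (j + 1) • (X ^ (j + 1) * Y ^ (N + 1 - (j + 1)))
      = 0 := by
    refine Finset.sum_eq_zero fun j hj => ?_
    have h1 := gauss_absorb Q N j
    rw [hQ.pow_eq_one, sub_self, zero_mul] at h1
    have h2 : 1 - Q ^ (j + 1) ≠ 0 := sub_ne_zero.mpr
      (hQ.pow_ne_one_of_pos_of_lt (by omega) (by have := Finset.mem_range.mp hj; omega)).symm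
    rw [(mul_eq_zero.mp h1).resolve_left h2, zero_smul]
  rw [this]
  simp [add_comm]

end qbinomial

section comul
variable {k : Type v} [Field k] (S : Datum k)

namespace Datum

/-- `φ₁₁(K ^ s) = (the remainder of s - 2 d modulo m) - (s - 2 d)`, for `0 ≤ s < m`. -/
def φ11 (f : ZMod S.m) : ℤ := ((f.val : ℤ) - 2 * S.n) % S.m - ((f.val : ℤ) - 2 * S.n)

/-- `φ₂₁(K ^ s) = (the remainder of s + 2 d modulo m) - (s + 2 d)`, for `0 ≤ s < m`. -/
def φ21 (f : ZMod S.m) : ℤ := ((f.val : ℤ) + 2 * S.n) % S.m - ((f.val : ℤ) + 2 * S.n)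

/-- `Φ₁(K ^ s, K ^ r) = ζ ^ (c r φ₁₁(K ^ s))`. -/
def Φ1 (f g : ZMod S.m) : k := S.ζ ^ ((S.n : ℤ) * g.val * S.φ11 f)

/-- `Φ₂(K ^ s, K ^ r) = ζ ^ (c r φ₂₁(K ^ s))`. -/
def Φ2 (f g : ZMod S.m) : k := S.ζ ^ ((S.n : ℤ) * g.val * S.φ21 f)

/-- The character `χ_g(K ^ r) = ξ_m ^ (t r)`, for `g = K ^ t`. -/
def χ (g h : ZMod S.m) : k := S.ξ ^ (g.val * h.val)

/-- The bare character of `ZMod m`. -/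
def ch (a : ZMod S.m) : k := S.ξ ^ a.val

theorem χ_eq (g h : ZMod S.m) : S.χ g h = S.ch (g * h) := by
  rw [χ, ch, ZMod.val_mul]
  exact pow_eq_pow_mod _ S.ξ_prim.pow_eq_one

theorem ch_add (a b : ZMod S.m) : S.ch (a + b) = S.ch a * S.ch b := by
  rw [ch, ch, ch, ZMod.val_add, ← pow_add]
  exact (pow_eq_pow_mod _ S.ξ_prim.pow_eq_one).symm

theorem ch_zero : S.ch 0 = 1 := by simp [ch]

theorem ch_neg_mul (a : ZMod S.m) : S.ch (-a) * S.ch a = 1 := by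
  rw [← ch_add, neg_add_cancel, ch_zero]

theorem one_lt_m : 1 < S.m := by
  have := S.two_lt
  unfold m
  nlinarith

theorem val_one : (1 : ZMod S.m).val = 1 := by
  have : Fact (1 < S.m) := ⟨S.one_lt_m⟩
  exact ZMod.val_one _

theorem ch_one : S.ch 1 = S.ξ := by rw [ch, val_one, pow_one]

theorem ch_natCast (j : ℕ) : S.ch j = S.ξ ^ j := by
  rw [ch, ZMod.val_natCast]
  exact (pow_eq_pow_mod _ S.ξ_prim.pow_eq_one).symm

theorem ch_eq_one {a : ZMod S.m} (h : S.ch a = 1) : a = 0 := by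
  have h1 := (S.ξ_prim.pow_eq_one_iff_dvd _).mp h
  have h2 := ZMod.val_lt a
  exact (ZMod.val_eq_zero a).mp (Nat.eq_zero_of_dvd_of_lt h1 h2)

open Classical in
theorem sum_ch (a : ZMod S.m) : ∑ h, S.ch (a * h) = if a = 0 then (S.m : k) else 0 := by
  split_ifs with ha
  · simp [ha, ch_zero, ZMod.card]
  · have h1 : S.ch a * ∑ h, S.ch (a * h) = ∑ h, S.ch (a * h) := by
      rw [Finset.mul_sum]
      refine Fintype.sum_equiv (Equiv.addRight 1) _ _ fun h => ?_
      rw [← ch_add]; congr 1; simp only [Equiv.coe_addRight]; ring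
    have h2 : (S.ch a - 1) * ∑ h, S.ch (a * h) = 0 := by rw [sub_mul, h1, one_mul, sub_self]
    exact (mul_eq_zero.mp h2).resolve_left (sub_ne_zero.mpr fun h => ha (S.ch_eq_one h))

/-- `2 n` modulo `m`. -/
def tw : ZMod S.m := ((2 * S.n : ℕ) : ZMod S.m)

theorem ch_tw : S.ch S.tw = S.q ^ 2 := by
  rw [tw, ch_natCast, q, ← pow_mul, mul_comm]

theorem ch_tw_mul (h : ZMod S.m) : S.ch (S.tw * h) = (S.q ^ 2) ^ h.val := by
  rw [← ch_tw, ← S.χ_eq, χ, ch, pow_mul]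

theorem two_n_lt : 2 * S.n < S.m := by
  have := S.two_lt
  unfold m
  nlinarith

theorem tw_val : S.tw.val = 2 * S.n := by
  rw [tw, ZMod.val_natCast, Nat.mod_eq_of_lt S.two_n_lt]

theorem φ11_eq (f : ZMod S.m) : S.φ11 f = ((f - S.tw).val : ℤ) - ((f.val : ℤ) - 2 * S.n) := by
  rw [φ11]
  congr 1
  have : f - S.tw = (((f.val : ℤ) - 2 * S.n : ℤ) : ZMod S.m) := by
    rw [tw]; push_cast; simp
  rw [this, ZMod.val_intCast]

theorem φ21_eq (f : ZMod S.m) : S.φ21 f = ((f + S.tw).val : ℤ) - ((f.val : ℤ) + 2 * S.n) := by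
  rw [φ21]
  congr 1
  have : f + S.tw = (((f.val : ℤ) + 2 * S.n : ℤ) : ZMod S.m) := by
    rw [tw]; push_cast; simp
  rw [this, ZMod.val_intCast]

theorem dvd_φ11 (f : ZMod S.m) : (S.m : ℤ) ∣ S.φ11 f :=
  (Int.mod_modEq _ _).symm.dvd

theorem dvd_φ21 (f : ZMod S.m) : (S.m : ℤ) ∣ S.φ21 f :=
  (Int.mod_modEq _ _).symm.dvd

theorem Φ_mul (f g : ZMod S.m) : S.Φ1 (f + S.tw) g * S.Φ2 f g = 1 := by
  rw [Φ1, Φ2, ← zpow_add₀ S.ζ_ne, φ11_eq, φ21_eq, add_sub_cancel_right]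
  convert zpow_zero S.ζ using 2
  ring

theorem Φ_mul' (f g : ZMod S.m) : S.Φ2 (f - S.tw) g * S.Φ1 f g = 1 := by
  have := S.Φ_mul (f - S.tw) g
  rwa [sub_add_cancel, mul_comm] at this

/-- Shifting the second argument by `2 n` does not change a power of this form. -/
theorem zpow_shift (g : ZMod S.m) {x : ℤ} (hx : (S.m : ℤ) ∣ x) :
    S.ζ ^ ((S.n : ℤ) * (g + S.tw).val * x) = S.ζ ^ ((S.n : ℤ) * g.val * x) := by
  obtain ⟨y, rfl⟩ := hx
  have h1 : ((g + S.tw).val : ℤ) = S.φ21 g + (g.val + 2 * S.n) := by rw [φ21_eq]; ring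
  obtain ⟨z, hz⟩ := S.dvd_φ21 g
  have h2 : (S.n : ℤ) * (g + S.tw).val * (S.m * y)
      = S.n * g.val * (S.m * y) + (((S.n ^ 2) ^ 2 : ℕ) : ℤ) * (S.n * z * y + 2 * y) := by
    have hm : (S.m : ℤ) = (S.n : ℤ) ^ 2 := by simp [m]
    rw [h1, hz, hm]; push_cast; ring
  rw [h2, zpow_add₀ S.ζ_ne, zpow_mul _ (((S.n ^ 2) ^ 2 : ℕ) : ℤ), zpow_natCast, S.prim.pow_eq_one,
    one_zpow, mul_one]

theorem Φ1_shift (f g : ZMod S.m) : S.Φ1 f (g + S.tw) = S.Φ1 f g :=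
  S.zpow_shift g (S.dvd_φ11 f)

theorem Φ2_shift (f g : ZMod S.m) : S.Φ2 f (g + S.tw) = S.Φ2 f g :=
  S.zpow_shift g (S.dvd_φ21 f)

/-- The coefficient `Φ₂(f, g) χ_g(K)`. -/
def Ψ (f g : ZMod S.m) : k := S.Φ2 f g * S.χ g 1

theorem Ψ_eq (f g : ZMod S.m) : S.Ψ f g = S.Φ2 f g * S.ch g := by
  rw [Ψ, χ_eq, mul_one]

end Datum

namespace H

/-- The element `1_g = |G|⁻¹ ∑_h χ_g(h) h` of the group algebra of `G = ⟨K⟩`; the element `K ^ s`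
of `G`, `0 ≤ s < m`, is indexed by the residue class of `s`. -/
def idem (g : ZMod S.m) : H S := (S.m : k)⁻¹ • ∑ h : ZMod S.m, S.χ g h • K S ^ h.val

theorem Kp_add (a b : ZMod S.m) : K S ^ (a + b).val = K S ^ a.val * K S ^ b.val := by
  rw [ZMod.val_add, ← pow_add]
  exact (pow_eq_pow_mod _ (rels S).Km).symm

theorem Kp_idem (a g : ZMod S.m) : K S ^ a.val * idem S g = S.ch (-(g * a)) • idem S g := by
  rw [idem, mul_smul_comm, smul_comm]
  congr 1
  rw [Finset.mul_sum, Finset.smul_sum]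
  refine Fintype.sum_equiv (Equiv.addLeft a) _ _ fun h => ?_
  rw [mul_smul_comm, ← Kp_add, smul_smul, S.χ_eq, S.χ_eq, ← S.ch_add]
  congr 2
  simp only [Equiv.coe_addLeft]; ring

theorem K_idem (g : ZMod S.m) : K S * idem S g = S.ch (-g) • idem S g := by
  have := Kp_idem S 1 g
  rwa [S.val_one, pow_one, mul_one] at this

open Classical in
theorem idem_mul (a b : ZMod S.m) : idem S a * idem S b = if a = b then idem S b else 0 := by
  conv_lhs => enter [1]; rw [idem]
  rw [smul_mul_assoc, Finset.sum_mul]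
  simp only [smul_mul_assoc, Kp_idem, smul_smul]
  rw [← Finset.sum_smul, smul_smul]
  have : ∀ h, S.χ a h * S.ch (-(b * h)) = S.ch ((a - b) * h) := by
    intro h; rw [S.χ_eq, ← S.ch_add]; congr 1; ring
  simp only [this, S.sum_ch, sub_eq_zero]
  split_ifs
  · rw [inv_mul_cancel₀ S.m_cast_ne, one_smul]
  · simp

theorem sum_idem : ∑ g, idem S g = 1 := by
  classical
  simp only [idem]
  rw [← Finset.smul_sum, Finset.sum_comm]
  have : ∀ h : ZMod S.m, ∑ g : ZMod S.m, S.χ g h • K S ^ h.val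
      = if h = 0 then (S.m : k) • 1 else 0 := by
    intro h
    rw [← Finset.sum_smul]
    have h1 : ∑ g, S.χ g h = ∑ g, S.ch (h * g) :=
      Finset.sum_congr rfl fun g _ => by rw [S.χ_eq, mul_comm]
    rw [h1, S.sum_ch]
    split_ifs with hh
    · simp [hh]
    · simp
  simp only [this]
  rw [Finset.sum_ite_eq' Finset.univ (0 : ZMod S.m) fun _ => (S.m : k) • (1 : H S)]
  simp [smul_smul, inv_mul_cancel₀ S.m_cast_ne]

theorem idem_comm_K (a : ZMod S.m) : idem S a * K S = K S * idem S a := by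
  rw [idem, smul_mul_assoc, mul_smul_comm, Finset.sum_mul, Finset.mul_sum]
  congr 1
  refine Finset.sum_congr rfl fun h _ => ?_
  rw [smul_mul_assoc, mul_smul_comm, ← pow_succ, ← pow_succ']

/-- An element that shifts the idempotents. -/
def Shifts (x : H S) (s : ZMod S.m) : Prop := ∀ a, idem S a * x = x * idem S (a + s)

theorem shifts_K : Shifts S (K S) 0 := fun a => by rw [idem_comm_K, add_zero]

theorem shifts_of {x : H S} {s : ZMod S.m}
    (hx : ∀ h : ZMod S.m, K S ^ h.val * x = S.ch (s * h) • (x * K S ^ h.val)) :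
    Shifts S x s := by
  intro a
  rw [idem, idem, smul_mul_assoc, mul_smul_comm, Finset.sum_mul, Finset.mul_sum]
  congr 1
  refine Finset.sum_congr rfl fun h _ => ?_
  rw [smul_mul_assoc, mul_smul_comm, hx, smul_smul, S.χ_eq, S.χ_eq, ← S.ch_add]
  congr 2; ring

theorem pow_mul_of {x : H S} {c : k} (hx : K S * x = c • (x * K S)) (j : ℕ) :
    K S ^ j * x = c ^ j • (x * K S ^ j) := by
  induction j with
  | zero => simp
  | succ j ih =>
    rw [pow_succ, mul_assoc, hx, mul_smul_comm, ← mul_assoc, ih, smul_mul_assoc, smul_smul,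
      mul_assoc, pow_succ, mul_comm c]

theorem shifts_E : Shifts S (E S) S.tw := shifts_of S fun h => by
  rw [pow_mul_of S (rels S).KE', S.ch_tw_mul]

theorem shifts_F : Shifts S (F S) (-S.tw) := shifts_of S fun h => by
  rw [pow_mul_of S (rels S).KF']
  congr 1
  have h1 : S.ch (-(S.tw * h)) * S.ch (S.tw * h) = 1 := S.ch_neg_mul _
  rw [neg_mul, eq_inv_of_mul_eq_one_left h1, S.ch_tw_mul, ← inv_pow]
  congr 1
  rw [zpow_neg]; norm_cast

/-- The diagonal elements `∑ c(a, b) 1_a ⊗ 1_b`. -/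
def diag (c : ZMod S.m → ZMod S.m → k) : H S ⊗[k] H S :=
  ∑ a, ∑ b, c a b • (idem S a ⊗ₜ[k] idem S b)

theorem diag_mul (c d : ZMod S.m → ZMod S.m → k) :
    diag S c * diag S d = diag S fun a b => c a b * d a b := by
  classical
  simp only [diag, Finset.sum_mul, Finset.mul_sum]
  refine Finset.sum_congr rfl fun a _ => Finset.sum_congr rfl fun b _ => ?_
  simp only [smul_mul_smul_comm, Algebra.TensorProduct.tmul_mul_tmul, idem_mul]
  rw [Finset.sum_eq_single a, Finset.sum_eq_single b]
  · simp
  · intro x _ hx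
    simp [hx]
  · simp
  · intro x _ hx
    refine Finset.sum_eq_zero fun y _ => ?_
    simp [hx]
  · simp

theorem diag_one : diag S (fun _ _ => 1) = 1 := by
  simp only [diag, one_smul]
  simp only [← TensorProduct.tmul_sum, ← TensorProduct.sum_tmul, sum_idem]
  rfl

theorem diag_smul (x : k) (c : ZMod S.m → ZMod S.m → k) :
    diag S (fun a b => x * c a b) = x • diag S c := by
  simp only [diag, Finset.smul_sum, smul_smul]

theorem diag_left {x : H S} {s : ZMod S.m} (hx : Shifts S x s)
    (c : ZMod S.m → ZMod S.m → k) :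
    diag S c * (x ⊗ₜ[k] 1) = (x ⊗ₜ[k] 1) * diag S fun a b => c (a - s) b := by
  simp only [diag, Finset.sum_mul, Finset.mul_sum]
  refine Fintype.sum_equiv (Equiv.addRight s) _ _ fun a => Finset.sum_congr rfl fun b _ => ?_
  simp only [Equiv.coe_addRight, add_sub_cancel_right, smul_mul_assoc, mul_smul_comm,
    Algebra.TensorProduct.tmul_mul_tmul, hx a, one_mul, mul_one]

theorem diag_right {x : H S} {s : ZMod S.m} (hx : Shifts S x s)
    (c : ZMod S.m → ZMod S.m → k) :
    diag S c * (1 ⊗ₜ[k] x) = (1 ⊗ₜ[k] x) * diag S fun a b => c a (b - s) := by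
  simp only [diag, Finset.sum_mul, Finset.mul_sum]
  refine Finset.sum_congr rfl fun a _ => ?_
  refine Fintype.sum_equiv (Equiv.addRight s) _ _ fun b => ?_
  simp only [Equiv.coe_addRight, add_sub_cancel_right, smul_mul_assoc, mul_smul_comm,
    Algebra.TensorProduct.tmul_mul_tmul, hx b, one_mul, mul_one]

theorem one_tmul_Kinv : (1 : H S) ⊗ₜ[k] Kinv S = diag S fun _ b => S.ch b := by
  have h : ∀ b, Kinv S * idem S b = S.ch b • idem S b := by
    intro b
    have h1 : Kinv S * (K S * idem S b) = idem S b := by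
      rw [← mul_assoc, (rels S).LK, one_mul]
    rw [K_idem, mul_smul_comm] at h1
    have h2 := congrArg (fun x => S.ch b • x) h1
    simp only [smul_smul] at h2
    rwa [mul_comm, S.ch_neg_mul, one_smul] at h2
  calc (1 : H S) ⊗ₜ[k] Kinv S = ((1 : H S) ⊗ₜ[k] Kinv S) * diag S fun _ _ => 1 := by
        rw [diag_one, mul_one]
    _ = _ := by
        simp only [diag, Finset.mul_sum, one_smul, Algebra.TensorProduct.tmul_mul_tmul, one_mul, h,
          TensorProduct.tmul_smul]

/-- `Δ(E) = ∑ Φ₁(f, g) E 1_f ⊗ 1_g + K ⊗ E`. -/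
def comulE : H S ⊗[k] H S :=
  (∑ f, ∑ g, S.Φ1 f g • ((E S * idem S f) ⊗ₜ[k] idem S g)) + K S ⊗ₜ[k] E S

/-- `Δ(F) = ∑ Φ₂(f, g) χ_g(K) F 1_f ⊗ 1_g + 1 ⊗ F`. -/
def comulF : H S ⊗[k] H S :=
  (∑ f, ∑ g, (S.Φ2 f g * S.χ g 1) • ((F S * idem S f) ⊗ₜ[k] idem S g)) + 1 ⊗ₜ[k] F S

theorem comulE_eq : comulE S = (E S ⊗ₜ[k] 1) * diag S S.Φ1 + (K S ⊗ₜ[k] 1) * (1 ⊗ₜ[k] E S) := by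
  simp only [comulE, diag, Finset.mul_sum, mul_smul_comm, Algebra.TensorProduct.tmul_mul_tmul,
    one_mul, mul_one]

theorem comulF_eq : comulF S = (F S ⊗ₜ[k] 1) * diag S S.Ψ + 1 ⊗ₜ[k] F S := by
  simp only [comulF, diag, Finset.mul_sum, mul_smul_comm, Algebra.TensorProduct.tmul_mul_tmul,
    one_mul, Datum.Ψ]

/-- Powers of `(x ⊗ 1) * diag c`. -/
theorem pow_diag {x : H S} {s : ZMod S.m} (hx : Shifts S x s)
    (c : ZMod S.m → ZMod S.m → k) (j : ℕ) :
    ∃ d, ((x ⊗ₜ[k] (1 : H S)) * diag S c) ^ j = ((x ^ j) ⊗ₜ[k] (1 : H S)) * diag S d := by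
  induction j with
  | zero => exact ⟨fun _ _ => 1, by rw [diag_one]; simp [Algebra.TensorProduct.one_def]⟩
  | succ j ih =>
    obtain ⟨d, hd⟩ := ih
    refine ⟨fun a b => d (a - s) b * c a b, ?_⟩
    rw [pow_succ, hd, mul_assoc, ← mul_assoc (diag S d), diag_left S hx, mul_assoc, diag_mul,
      ← mul_assoc, Algebra.TensorProduct.tmul_mul_tmul, ← pow_succ, one_mul]

theorem comul_rel : Relations S (comulE S) (comulF S) (K S ⊗ₜ[k] K S) (Kinv S ⊗ₜ[k] Kinv S) := by
  have R := rels S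
  have KE := R.KE'
  have KF := R.KF'
  -- elementary commutations
  have cDK : ∀ c, diag S c * (K S ⊗ₜ[k] 1) = (K S ⊗ₜ[k] 1) * diag S c := by
    intro c; rw [diag_left S (shifts_K S)]; simp only [sub_zero]
  have cDK' : ∀ c, diag S c * (1 ⊗ₜ[k] K S) = (1 ⊗ₜ[k] K S) * diag S c := by
    intro c; rw [diag_right S (shifts_K S)]; simp only [sub_zero]
  have split : ∀ x y : H S, x ⊗ₜ[k] y = (x ⊗ₜ[k] 1) * (1 ⊗ₜ[k] y) := by
    intro x y; simp
  have swap : ∀ x y : H S, ((1 : H S) ⊗ₜ[k] y) * (x ⊗ₜ[k] 1) = (x ⊗ₜ[k] 1) * (1 ⊗ₜ[k] y) := by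
    intro x y; simp
  have cDKK : ∀ c, diag S c * (K S ⊗ₜ[k] K S) = (K S ⊗ₜ[k] K S) * diag S c := by
    intro c
    rw [split, ← mul_assoc, cDK, mul_assoc, cDK', mul_assoc]
  have hLL : (K S ⊗ₜ[k] K S) * (Kinv S ⊗ₜ[k] Kinv S) = 1 := by
    rw [Algebra.TensorProduct.tmul_mul_tmul, R.KL]; rfl
  have conj : ∀ (x : H S) (e : k) (c : ZMod S.m → ZMod S.m → k), K S * x = e • (x * K S) →
      (K S ⊗ₜ[k] K S) * ((x ⊗ₜ[k] 1) * diag S c) * (Kinv S ⊗ₜ[k] Kinv S)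
        = e • ((x ⊗ₜ[k] 1) * diag S c) := by
    intro x e c hx
    have h1 : (K S ⊗ₜ[k] K S) * (x ⊗ₜ[k] (1 : H S)) = e • ((x ⊗ₜ[k] 1) * (K S ⊗ₜ[k] K S)) := by
      simp only [Algebra.TensorProduct.tmul_mul_tmul, hx, mul_one, one_mul,
        TensorProduct.smul_tmul']
    rw [← mul_assoc, h1, smul_mul_assoc, smul_mul_assoc, mul_assoc _ _ (diag S c), ← cDKK,
      ← mul_assoc, mul_assoc, hLL, mul_one]
  have Ψs : ∀ a b, S.Ψ a (b + S.tw) = S.q ^ 2 * S.Ψ a b := by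
    intro a b
    rw [S.Ψ_eq, S.Ψ_eq, S.Φ2_shift, S.ch_add, S.ch_tw]; ring
  have Φs : ∀ a b, S.Φ1 a (b - S.tw) = S.Φ1 a b := by
    intro a b
    have := S.Φ1_shift a (b - S.tw)
    rw [sub_add_cancel] at this
    exact this.symm
  have hE1 := diag_right S (shifts_E S)
  have hF1 := diag_right S (shifts_F S)
  have hE0 := diag_left S (shifts_E S)
  have hF0 := diag_left S (shifts_F S)
  have q2 : S.q ^ 2 ≠ 0 := pow_ne_zero _ S.q_ne
  have qz : S.q ^ (-2 : ℤ) = (S.q ^ 2)⁻¹ := by rw [zpow_neg]; norm_cast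
  have Ψs' : ∀ a b, S.Ψ a (b - S.tw) = S.q ^ (-2 : ℤ) * S.Ψ a b := by
    intro a b
    have := Ψs a (b - S.tw)
    rw [sub_add_cancel] at this
    rw [this, qz, inv_mul_cancel_left₀ q2]
  set X := (E S ⊗ₜ[k] 1) * diag S S.Φ1 with hX
  set Y := (K S ⊗ₜ[k] (1 : H S)) * ((1 : H S) ⊗ₜ[k] E S) with hY
  set Z := (F S ⊗ₜ[k] 1) * diag S S.Ψ with hZ
  set W := (1 : H S) ⊗ₜ[k] F S with hW
  have hXZ : X * Z = (E S * F S) ⊗ₜ[k] Kinv S := by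
    rw [hX, hZ, mul_assoc, ← mul_assoc (diag S _), hF0, mul_assoc, diag_mul, ← mul_assoc,
      Algebra.TensorProduct.tmul_mul_tmul, one_mul, split _ (Kinv S), one_tmul_Kinv]
    congr 2
    funext a b
    rw [sub_neg_eq_add, S.Ψ_eq, ← mul_assoc, S.Φ_mul, one_mul]
  have hZX : Z * X = (F S * E S) ⊗ₜ[k] Kinv S := by
    rw [hX, hZ, mul_assoc, ← mul_assoc (diag S _), hE0, mul_assoc, diag_mul, ← mul_assoc,
      Algebra.TensorProduct.tmul_mul_tmul, one_mul, split _ (Kinv S), one_tmul_Kinv]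
    congr 2
    funext a b
    rw [S.Ψ_eq, mul_right_comm, S.Φ_mul', one_mul]
  have hXW : X * W = W * X := by
    rw [hX, hW, mul_assoc, hF1, ← mul_assoc, ← mul_assoc, swap]
    congr 2
    funext a b
    rw [sub_neg_eq_add, S.Φ1_shift]
  have hKF : (K S ⊗ₜ[k] (1 : H S)) * (F S ⊗ₜ[k] 1)
      = S.q ^ (-2 : ℤ) • ((F S ⊗ₜ[k] 1) * (K S ⊗ₜ[k] 1)) := by
    simp only [Algebra.TensorProduct.tmul_mul_tmul, KF, mul_one, TensorProduct.smul_tmul']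
  have hKE : (K S ⊗ₜ[k] (1 : H S)) * (E S ⊗ₜ[k] 1)
      = S.q ^ 2 • ((E S ⊗ₜ[k] 1) * (K S ⊗ₜ[k] 1)) := by
    simp only [Algebra.TensorProduct.tmul_mul_tmul, KE, mul_one, TensorProduct.smul_tmul']
  have hYZ : Y * Z = Z * Y := by
    have e1 : Y * Z = S.q ^ (-2 : ℤ) •
        ((F S ⊗ₜ[k] 1) * ((K S ⊗ₜ[k] 1) * ((1 ⊗ₜ[k] E S) * diag S S.Ψ))) := by
      rw [hY, hZ, mul_assoc, ← mul_assoc (1 ⊗ₜ[k] E S), swap, mul_assoc, ← mul_assoc, hKF,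
        smul_mul_assoc, mul_assoc]
    rw [e1, hY, hZ, mul_assoc, ← mul_assoc (diag S _), cDK, mul_assoc, hE1]
    simp only [Ψs', diag_smul, mul_smul_comm]
  have hYW : Y * W - W * Y = K S ⊗ₜ[k] (E S * F S - F S * E S) := by
    rw [hY, hW]
    simp only [Algebra.TensorProduct.tmul_mul_tmul, one_mul, mul_one, TensorProduct.tmul_sub]
  have hYX : Y * X = S.q ^ 2 • (X * Y) := by
    have e1 : Y * X = S.q ^ 2 •
        ((E S ⊗ₜ[k] 1) * ((K S ⊗ₜ[k] 1) * ((1 ⊗ₜ[k] E S) * diag S S.Φ1))) := by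
      rw [hY, hX, mul_assoc, ← mul_assoc (1 ⊗ₜ[k] E S), swap, mul_assoc, ← mul_assoc, hKE,
        smul_mul_assoc, mul_assoc]
    rw [e1, hY, hX, mul_assoc (E S ⊗ₜ[k] 1), ← mul_assoc (diag S _), cDK, mul_assoc _ (diag S _),
      hE1]
    simp only [Φs]
  have hZW : Z * W = S.q ^ 2 • (W * Z) := by
    rw [hZ, hW, mul_assoc, hF1, ← mul_assoc, ← mul_assoc, swap]
    simp only [sub_neg_eq_add, Ψs, diag_smul, mul_smul_comm, hW]
  rw [comulE_eq, comulF_eq]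
  refine ⟨hLL, ?_, ?_, ?_, ?_, ?_, ?_, ?_⟩
  · rw [Algebra.TensorProduct.tmul_mul_tmul, R.LK]; rfl
  · rw [mul_add, add_mul, conj _ _ _ KE, smul_add]
    congr 1
    simp only [Algebra.TensorProduct.tmul_mul_tmul, one_mul, mul_one, R.KE, mul_assoc, R.KL]
    rw [TensorProduct.tmul_smul]
  · rw [mul_add, add_mul, conj _ _ _ KF, smul_add]
    congr 1
    simp only [Algebra.TensorProduct.tmul_mul_tmul, mul_one, R.KF, R.KL,
      TensorProduct.tmul_smul]
  · have : (X + Y) * (Z + W) - (Z + W) * (X + Y)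
        = (X * Z - Z * X) + (Y * W - W * Y) + (X * W - W * X) + (Y * Z - Z * Y) := by
      noncomm_ring
    rw [this, hXW, hYZ, hYW, hXZ, hZX, ← TensorProduct.sub_tmul, R.EF, sub_self, sub_self,
      add_zero, add_zero, TensorProduct.tmul_smul, ← TensorProduct.smul_tmul', ← smul_add,
      TensorProduct.sub_tmul, TensorProduct.tmul_sub]
    congr 1
    abel
  · rw [add_pow_root S.n_pos S.q2_prim hYX]
    obtain ⟨d, hd⟩ := pow_diag S (shifts_E S) S.Φ1 S.n
    rw [← hX] at hd
    rw [hd, R.En, hY, Algebra.TensorProduct.tmul_mul_tmul, Algebra.TensorProduct.tmul_pow, one_mul,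
      R.En]
    simp
  · rw [add_comm, add_pow_root S.n_pos S.q2_prim hZW]
    obtain ⟨d, hd⟩ := pow_diag S (shifts_F S) S.Ψ S.n
    rw [← hZ] at hd
    rw [hd, R.Fn, hW, Algebra.TensorProduct.tmul_pow, R.Fn]
    simp
  · rw [Algebra.TensorProduct.tmul_pow, R.Km]; rfl

/-- The comultiplication `Δ`, with `Δ(K) = K ⊗ K`. -/
def comul : H S →ₐ[k] H S ⊗[k] H S := lift S (comul_rel S)

end H

variable (M N : Type*) [AddCommGroup M] [Module k M] [Module (H S) M] [IsScalarTower k (H S) M]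
  [AddCommGroup N] [Module k N] [Module (H S) N] [IsScalarTower k (H S) N]

/-- The action of `H` on `M ⊗ N` through `Δ`. -/
def tensorRep : H S →ₐ[k] Module.End k (M ⊗[k] N) :=
  (Module.endTensorEndAlgHom (R := k) (S := k) (A := k) (M := M) (N := N)).comp
    ((Algebra.TensorProduct.map (Algebra.lsmul k k M : H S →ₐ[k] Module.End k M)
      (Algebra.lsmul k k N : H S →ₐ[k] Module.End k N)).comp (H.comul S))

/-- The `H`-module `M ⊗ N`. -/
@[nolint unusedArguments]
def Tens (_S : Datum k) (M N : Type*) [AddCommGroup M] [Module k M] [AddCommGroup N]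
    [Module k N] := M ⊗[k] N

instance : AddCommGroup (Tens S M N) := inferInstanceAs (AddCommGroup (M ⊗[k] N))
instance : Module k (Tens S M N) := inferInstanceAs (Module k (M ⊗[k] N))
instance : Module (H S) (Tens S M N) :=
  Module.compHom (M ⊗[k] N) (tensorRep S M N).toRingHom

theorem Tens_smul (x : H S) (v : Tens S M N) : x • v = tensorRep S M N x v := rfl

instance : IsScalarTower k (H S) (Tens S M N) where
  smul_assoc c x v := by
    rw [Tens_smul, Tens_smul, map_smul]; rfl

end comul

end SmallQuasi

end

/-! Write $N$ for the tensor product, $w_0$ for the lowest weight vector of the first factor and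
$w'_{n-1}$ for the highest weight vector of the second. The vector $x=w_0\otimes w'_{n-1}$ generates
$N$: repeated use of $F$ kills the first leg and lowers the second, because every $\gamma_j$ with
$0<j<n$ is nonzero, and then $E$ raises the first leg modulo tensors already reached
(`tens_generated`). Since $t+t'=n$, the scalar by which $K$ acts on $x$ is $q^a$ with $a=2u-1$.

Let $1_g$ be the idempotent of weight $q^a$. The left ideal $H1_g$ is spanned by the $n^2$ elements
$E^iF^j1_g$ and surjects onto $N$, which has dimension $n^2$. Hence $N\cong H1_g$ is projective, and
a map $N\to M$ is the same as a vector of weight $q^a$ in $M$ (`nonempty_equiv_pi_of_finrank`).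

It remains to find the simple quotients. The central element $K^n$ fixes $x$, hence acts trivially
on $N$, and the simple modules with this property are $V_1,\dots,V_n$
(`V.exists_equiv_of_isSimpleModule`). Each has weight spaces of dimension at most one, so $V_l$
occurs in the top of $N$ once if $q^a$ is a weight of $V_l$, and not at all otherwise. Uniqueness of
projective covers turns this into $N\cong\prod P_l$ over those $l$ (`nonempty_equiv_pi_of_cyclic`).
Solving $2j+1-l\equiv 2u-1 \pmod n$ with $0\le j<l\le n$ gives the two lists.

Finally, $P_l$ determines its simple top $V_l$, hence $l$. The module $V_n$ is its own projective
cover, being a direct summand of $H$ (`V.projective`). -/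

noncomputable section

namespace SmallQuasi

universe v

/-! ### Projective covers: uniqueness, finite products, simple tops. -/

section projectiveCovers
variable {A : Type*} [Ring A]

namespace IsProjectiveCover
variable {P P' M M' : Type*} [AddCommGroup P] [Module A P] [AddCommGroup P'] [Module A P']
  [AddCommGroup M] [Module A M] [AddCommGroup M'] [Module A M']

/-- A projective module is its own projective cover. -/
theorem refl [Module.Projective A P] : IsProjectiveCover (LinearMap.id : P →ₗ[A] P) where
  projective := inferInstance
  surjective := Function.surjective_id
  superfluous N hN := by simpa using hN

/-- Projective covers are unique up to isomorphism. -/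
theorem nonempty_equiv {π : P →ₗ[A] M} {π' : P' →ₗ[A] M} (h : IsProjectiveCover π)
    (h' : IsProjectiveCover π') : Nonempty (P ≃ₗ[A] P') := by
  have := h.projective
  have := h'.projective
  obtain ⟨g, hg⟩ := Module.projective_lifting_property π' π h'.surjective
  have hg' : ∀ x, π' (g x) = π x := fun x => LinearMap.congr_fun hg x
  -- A lift of a surjection has an image that, together with the kernel of `π'`, fills the module;
  -- superfluity then makes `g` onto. The same argument applied to a section `s` of `g` makes `s`
  -- bijective.
  have hgs : LinearMap.range g = ⊤ := by
    refine h'.superfluous _ (eq_top_iff.mpr fun y _ => ?_)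
    obtain ⟨x, hx⟩ := h.surjective (π' y)
    refine Submodule.mem_sup.mpr ⟨g x, ⟨x, rfl⟩, y - g x, ?_, by abel⟩
    rw [LinearMap.mem_ker, map_sub, hg', hx, sub_self]
  obtain ⟨s, hs⟩ := Module.projective_lifting_property g LinearMap.id
    (LinearMap.range_eq_top.mp hgs)
  have hs' : ∀ y, g (s y) = y := fun y => LinearMap.congr_fun hs y
  have hss : LinearMap.range s = ⊤ := by
    refine h.superfluous _ (eq_top_iff.mpr fun x _ => ?_)
    refine Submodule.mem_sup.mpr ⟨s (g x), ⟨_, rfl⟩, x - s (g x), ?_, by abel⟩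
    rw [LinearMap.mem_ker, map_sub, ← hg' (s _), hs', hg', sub_self]
  exact ⟨(LinearEquiv.ofBijective s
    ⟨Function.LeftInverse.injective hs', LinearMap.range_eq_top.mp hss⟩).symm⟩

/-- A finite product of projective covers is a projective cover. -/
theorem pi {ι : Type*} [Finite ι] {P M : ι → Type*} [∀ i, AddCommGroup (P i)]
    [∀ i, Module A (P i)] [∀ i, AddCommGroup (M i)] [∀ i, Module A (M i)]
    [∀ i, Module.Finite A (P i)] {π : ∀ i, P i →ₗ[A] M i} (h : ∀ i, IsProjectiveCover (π i)) :
    IsProjectiveCover (LinearMap.pi fun i => π i ∘ₗ LinearMap.proj i) where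
  projective := by
    classical
    have := fun i => (h i).projective
    have := Fintype.ofFinite ι
    exact Module.Projective.of_equiv (DirectSum.linearEquivFunOnFintype A ι P)
  surjective y := by
    choose x hx using fun i => (h i).surjective (y i)
    exact ⟨x, funext hx⟩
  superfluous N hN := by
    classical
    by_contra hne
    -- Passing to a coatom `C` allows work on one factor at a time: the preimage of `C` in a factor
    -- is a coatom or everything, and in both cases contains the superfluous kernel of `π i`.
    obtain ⟨C, hC, hNC⟩ := (eq_top_or_exists_le_coatom N).resolve_left hne
    refine hC.1 (top_le_iff.mp (hN ▸ sup_le hNC fun x hx => ?_))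
    have := Fintype.ofFinite ι
    rw [← LinearMap.sum_single_apply P x]
    refine Submodule.sum_mem _ fun i _ => ?_
    have hxi : x i ∈ LinearMap.ker (π i) := congrFun (LinearMap.mem_ker.mp hx) i
    rcases Submodule.isCoatom_comap_or_eq_top (LinearMap.single A P i) hC with hc | hc
    · by_contra hni
      have h1 : C.comap (LinearMap.single A P i) ⊔ LinearMap.ker (π i) = ⊤ :=
        hc.2 _ (lt_of_le_not_ge le_sup_left fun hle => hni (hle (le_sup_right
          (a := C.comap (LinearMap.single A P i)) hxi)))
      exact hc.1 ((h i).superfluous _ h1)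
    · exact (hc ▸ Submodule.mem_top : x i ∈ C.comap (LinearMap.single A P i))

/-- The simple module is determined by its projective cover. -/
theorem nonempty_equiv_of_isSimpleModule [IsSimpleModule A M] [IsSimpleModule A M']
    {π : P →ₗ[A] M} {π' : P →ₗ[A] M'} (h : IsProjectiveCover π) (h' : Function.Surjective π') :
    Nonempty (M ≃ₗ[A] M') := by
  have hc := LinearMap.isCoatom_ker_of_surjective h.surjective
  have hc' := LinearMap.isCoatom_ker_of_surjective h'
  -- Two distinct maximal submodules would span everything, against superfluity of the kernel of
  -- `π`.
  have hker : LinearMap.ker π = LinearMap.ker π' := by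
    by_contra hne
    exact hc'.1 (h.superfluous _ (hc'.sup_eq_top_of_ne hc (Ne.symm hne)))
  exact ⟨(π.quotKerEquivOfSurjective h.surjective).symm ≪≫ₗ
    Submodule.quotEquivOfEq _ _ hker ≪≫ₗ π'.quotKerEquivOfSurjective h'⟩

end IsProjectiveCover
end projectiveCovers

/-! ### Powers of $q$, weights of $K$, and the idempotents $1_g$. -/

section weights
variable {k : Type v} [Field k] (S : Datum k)

theorem Datum.q_zpow_eq_iff {a b : ℤ} : S.q ^ a = S.q ^ b ↔ (S.n : ℤ) ∣ a - b := by
  rw [← S.q_prim.zpow_eq_one_iff_dvd, zpow_sub₀ S.q_ne, div_eq_one_iff_eq (zpow_ne_zero _ S.q_ne)]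

/-- The oddness of $n$ enters here: 2 is invertible modulo $n$, so weights differing by powers of
$q^2$ can be told apart. -/
theorem Datum.dvd_of_dvd_two_mul {x : ℤ} (h : (S.n : ℤ) ∣ 2 * x) : (S.n : ℤ) ∣ x :=
  Int.dvd_of_dvd_mul_right_of_gcd_one h (by
    rw [Int.gcd_comm]
    change Int.gcd ((2 : ℕ) : ℤ) S.n = 1
    rw [Int.gcd_natCast_natCast]
    exact Nat.coprime_two_left.mpr S.n_odd)

theorem Datum.exists_zpow_eq {c : k} (h : c ^ S.n = 1) : ∃ a : ℤ, S.q ^ a = c := by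
  have := NeZero.mk S.n_pos.ne'
  obtain ⟨i, -, hi⟩ := S.q_prim.eq_pow_of_pow_eq_one h
  exact ⟨i, by simpa using hi⟩

/-- Every power of `q` is the lowest weight `q ^ (1 - l)` of a unique `V_l`, `1 ≤ l ≤ n`. -/
theorem Datum.exists_lowest (a : ℤ) : ∃ l : ℕ, 1 ≤ l ∧ l ≤ S.n ∧ S.q ^ (1 - l : ℤ) = S.q ^ a := by
  have hn : (0 : ℤ) < S.n := by exact_mod_cast S.n_pos
  have h1 := Int.emod_nonneg (-a) hn.ne'
  have h2 := Int.emod_lt_of_pos (-a) hn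
  obtain ⟨j, hj⟩ := Int.eq_ofNat_of_zero_le h1
  -- With $j$ the remainder of $-a$ and $l=j+1$, the exponent $1-l=-j$ is congruent to $a$.
  refine ⟨j + 1, by omega, by omega, S.q_zpow_eq_iff.mpr ?_⟩
  have h3 := Int.dvd_self_sub_emod (x := -a) (m := S.n)
  have : (1 - (j + 1 : ℕ) : ℤ) - a = -a - (-a) % S.n := by rw [hj]; push_cast; ring
  rwa [this]

/-- Since $K1_g=\mathrm{ch}(-g)1_g$, this finds an idempotent for each weight that is a power of
$\mathbf q$. -/
theorem Datum.exists_ch_neg (a : ℤ) : ∃ g : ZMod S.m, S.ch (-g) = S.ξ ^ a := by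
  have hm : (S.m : ℤ) ≠ 0 := by exact_mod_cast S.m_pos.ne'
  obtain ⟨j, hj⟩ := Int.eq_ofNat_of_zero_le (Int.emod_nonneg a hm)
  refine ⟨-(j : ZMod S.m), ?_⟩
  rw [neg_neg, S.ch_natCast, ← zpow_natCast]
  replace hj : a % S.m = (j : ℤ) := hj
  rw [← hj]
  conv_rhs => rw [← Int.emod_add_mul_ediv a S.m, zpow_add₀ S.ξ_ne, zpow_mul, zpow_natCast,
    S.ξ_prim.pow_eq_one, one_zpow, mul_one]

theorem Datum.q_zpow (a : ℤ) : S.q ^ a = S.ξ ^ (S.n * a : ℤ) := by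
  rw [zpow_mul, zpow_natCast]; rfl

variable {Q : Type*} [AddCommGroup Q] [Module k Q] [Module (H S) Q] [IsScalarTower k (H S) Q]

variable {S} in
theorem pow_smul_of_smul_eq {x : H S} {c : k} {v : Q} (h : x • v = c • v) (j : ℕ) :
    x ^ j • v = c ^ j • v := by
  induction j with
  | zero => simp
  | succ j ih => rw [pow_succ', mul_smul, ih, smul_comm, h, smul_smul, pow_succ]

theorem H.K_idem_smul (g : ZMod S.m) (v : Q) :
    H.K S • H.idem S g • v = S.ch (-g) • H.idem S g • v := by
  rw [← mul_smul, H.K_idem, smul_assoc]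

-- On a vector of this weight each $h\in G$ acts by the inverse of $\chi_g(h)$, so the average
-- defining $1_g$ has all its terms equal to the vector. This is what lets $1_g$ be sent to an
-- arbitrary vector of its weight.
variable {S} in
theorem H.idem_smul_of_weight {g : ZMod S.m} {v : Q} (h : H.K S • v = S.ch (-g) • v) :
    H.idem S g • v = v := by
  have h1 : ∀ x : ZMod S.m, S.χ g x * S.ch (-g) ^ x.val = 1 := by
    intro x
    rw [Datum.χ, pow_mul, ← mul_pow]
    change (S.ch g * S.ch (-g)) ^ _ = 1
    rw [← S.ch_add, add_neg_cancel, S.ch_zero, one_pow]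
  rw [H.idem, smul_assoc, Finset.sum_smul]
  simp only [smul_assoc, pow_smul_of_smul_eq h, smul_smul, h1, one_smul]
  rw [Finset.sum_const, Finset.card_univ, ZMod.card, ← Nat.cast_smul_eq_nsmul k, smul_smul,
    inv_mul_cancel₀ S.m_cast_ne, one_smul]

-- The $1_g$ sum to 1. This produces weight vectors without diagonalising $K$.
omit [Module k Q] [IsScalarTower k (H S) Q] in
theorem H.exists_idem_smul_ne {v : Q} (hv : v ≠ 0) : ∃ g, H.idem S g • v ≠ 0 := by
  by_contra! h
  apply hv
  rw [← one_smul (H S) v, ← H.sum_idem, Finset.sum_smul]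
  exact Finset.sum_eq_zero fun g _ => h g

/-- Induction on the generators, without `K⁻¹`. -/
theorem H.generators_induction {C : H S → Prop} (hs : ∀ c : k, C (algebraMap k _ c))
    (hE : C (H.E S)) (hF : C (H.F S)) (hK : C (H.K S)) (hm : ∀ x y, C x → C y → C (x * y))
    (ha : ∀ x y, C x → C y → C (x + y)) (x : H S) : C x := by
  refine H.induction S hs (fun g => ?_) hm ha x
  cases g
  · exact hE
  · exact hF
  · exact hK
  · change C (H.Kinv S)
    rw [(H.rels S).L_eq]
    generalize S.m - 1 = j
    induction j with
    | zero => simpa using hs 1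
    | succ j ih => exact pow_succ (H.K S) j ▸ hm _ _ ih hK

variable {S} in
/-- A linear map that commutes with `E`, `F` and `K` is a map of `H`-modules. -/
def linearMapOfGenerators {Q' : Type*} [AddCommGroup Q'] [Module k Q'] [Module (H S) Q']
    [IsScalarTower k (H S) Q'] (f : Q →ₗ[k] Q') (hE : ∀ v, f (H.E S • v) = H.E S • f v)
    (hF : ∀ v, f (H.F S • v) = H.F S • f v) (hK : ∀ v, f (H.K S • v) = H.K S • f v) :
    Q →ₗ[H S] Q' where
  toFun := f
  map_add' := map_add f
  map_smul' x := by
    induction x using H.generators_induction S with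
    | hs c => intro v; simp [algebraMap_smul]
    | hE => exact hE
    | hF => exact hF
    | hK => exact hK
    | hm x y hx hy =>
      intro v
      simp only [RingHom.id_apply] at hx hy ⊢
      rw [mul_smul, hx, hy, mul_smul]
    | ha x y hx hy =>
      intro v
      simp only [RingHom.id_apply] at hx hy ⊢
      rw [add_smul, map_add, hx, hy, add_smul]

end weights

/-! ### The modules $V_l$: multiplicity-free weights and simplicity. -/

section simple
variable {k : Type v} [Field k] (S : Datum k)

namespace V

/-- The basis vectors of `V_l`, indexed from `0`; zero for `i ≥ l`. -/
def w (l i : ℕ) : V S l := vec k l i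

theorem w_ne {l i : ℕ} (h : i < l) : w S l i ≠ 0 := by
  intro h0
  have := congrFun h0 ⟨i, h⟩
  rw [w, vec, dif_pos h, Pi.single_eq_same] at this
  exact one_ne_zero this

variable {S} {l : ℕ}

theorem E_smul (hl : l ≤ S.n) (i : ℕ) : H.E S • w S l i = w S l (i + 1) := by
  rw [V_smul, simpleRep, dif_pos hl, H.E, H.lift_gen]
  exact opE_vec l i

theorem F_smul (hl : l ≤ S.n) (i : ℕ) : H.F S • w S l i = β S l i • w S l (i - 1) := by
  rw [V_smul, simpleRep, dif_pos hl, H.F, H.lift_gen]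
  exact opF_vec (by simp [β, α]) (by simp [β, α]) i

theorem K_smul (hl : l ≤ S.n) (i : ℕ) : H.K S • w S l i = simpleWt S l i • w S l i := by
  rw [V_smul, simpleRep, dif_pos hl, H.K, H.lift_gen]
  exact opK_vec l _ i

theorem Kinv_smul (hl : l ≤ S.n) (i : ℕ) :
    H.Kinv S • w S l i = (simpleWt S l i)⁻¹ • w S l i := by
  rw [V_smul, simpleRep, dif_pos hl, H.Kinv, H.lift_gen]
  exact opK_vec l (fun i => (simpleWt S l i)⁻¹) i

theorem eq_sum (v : V S l) : v = ∑ i : Fin l, v i • w S l i := by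
  have h : ∀ v : Fin l → k, v = ∑ i : Fin l, v i • vec k l i := fun v => by
    simp only [vec_of_lt]
    exact ((Pi.basisFun k (Fin l)).sum_repr v).symm
  exact h v

theorem E_pow_smul (hl : l ≤ S.n) (i j : ℕ) : H.E S ^ j • w S l i = w S l (i + j) := by
  induction j with
  | zero => simp
  | succ j ih => rw [pow_succ', mul_smul, ih, E_smul hl, add_assoc]

theorem K_smul_apply (hl : l ≤ S.n) (v : V S l) (i : Fin l) :
    (H.K S • v) i = simpleWt S l i * v i := by
  rw [V_smul, simpleRep, dif_pos hl, H.K, H.lift_gen]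
  change opK l (simpleWt S l) v i = _
  have : opK l (simpleWt S l) = LinearMap.pi fun i : Fin l => simpleWt S l i •
      LinearMap.proj (R := k) (φ := fun _ : Fin l => k) i := by
    refine (Pi.basisFun k (Fin l)).ext fun i => ?_
    rw [← vec_of_lt, opK_vec]
    ext j
    by_cases h : j = i <;> simp [vec, h]
  rw [this]; rfl

theorem simpleWt_eq (i : ℕ) : simpleWt S l i = S.q ^ (2 * i + 1 - l : ℤ) := by
  rw [simpleWt]; congr 1; ring

/-- The weights are consecutive powers of $q^2$, an element of order $n$, and there are only $l\le
n$ of them. -/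
theorem simpleWt_injOn (hl : l ≤ S.n) {i j : ℕ} (hi : i < l) (hj : j < l)
    (h : simpleWt S l i = simpleWt S l j) : i = j := by
  rw [simpleWt_eq, simpleWt_eq, S.q_zpow_eq_iff] at h
  have h1 : (S.n : ℤ) ∣ i - j := S.dvd_of_dvd_two_mul (by convert h using 1; ring)
  have h2 := Int.eq_zero_of_abs_lt_dvd h1 (abs_lt.mpr ⟨by omega, by omega⟩)
  omega

/-- Multiplicity one: since $K$ is diagonal with distinct entries, a weight vector has a single
nonzero coordinate. -/
theorem exists_eq_smul_of_weight (hl : l ≤ S.n) {v : V S l} (hv : v ≠ 0) {c : k}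
    (h : H.K S • v = c • v) :
    ∃ i < l, simpleWt S l i = c ∧ ∃ d : k, d ≠ 0 ∧ v = d • w S l i := by
  have h1 : ∀ i : Fin l, v i ≠ 0 → simpleWt S l i = c := fun i hi => by
    have := congrFun h i
    rw [K_smul_apply hl] at this
    exact mul_right_cancel₀ hi this
  obtain ⟨i, hi⟩ : ∃ i, v i ≠ 0 := by
    by_contra! h0
    exact hv (funext h0)
  refine ⟨i, i.2, h1 i hi, v i, hi, ?_⟩
  conv_lhs => rw [eq_sum v]
  refine Finset.sum_eq_single i (fun j _ hj => ?_) (by simp)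
  have : v j = 0 := by
    by_contra h0
    exact hj (Fin.ext (simpleWt_injOn hl j.2 i.2 ((h1 j h0).trans (h1 i hi).symm)))
  rw [this, zero_smul]

/-- For $0<i<l\le n$ neither $q^{2i}$ nor $q^{2(i-l)}$ is 1, so both factors of $\alpha_i(l)$
survive. Hence $F$ can be undone up to a scalar on every basis vector except the lowest. -/
theorem β_ne (hl : l ≤ S.n) {i : ℕ} (h0 : 0 < i) (hi : i < l) : β S l i ≠ 0 := by
  have hq2 := sub_ne_zero.mpr S.q2_ne_one
  have h1 : ∀ j : ℤ, S.q ^ j ≠ 0 := fun j => zpow_ne_zero _ S.q_ne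
  refine div_ne_zero (mul_ne_zero ?_ ?_) ?_
  · rw [geom_sum_eq S.q2_ne_one]
    exact div_ne_zero (sub_ne_zero.mpr (S.q2_prim.pow_ne_one_of_pos_of_lt h0.ne' (by omega))) hq2
  · rw [sub_ne_zero, ← zpow_zero S.q, Ne, S.q_zpow_eq_iff]
    intro h
    have h2 : (S.n : ℤ) ∣ l - i := S.dvd_of_dvd_two_mul (by convert h using 1; ring)
    have := Int.le_of_dvd (by omega) h2
    omega
  · rw [sub_ne_zero, Ne, S.q_zpow_eq_iff]
    intro h
    have h2 : (S.n : ℤ) ∣ 1 := S.dvd_of_dvd_two_mul (by convert h using 1; ring)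
    have := Int.le_of_dvd (by omega) h2
    have := S.two_lt
    omega

/-- Read off from the relation for $EF-FE$ applied to a basis vector of $V_l$. This recursion
carries the coefficients $\beta_i(l)$ over to arbitrary lowest weight vectors. -/
theorem β_sub (hl : l ≤ S.n) {i : ℕ} (hi : i < l) :
    β S l i - β S l (i + 1) = (S.q - S.q⁻¹)⁻¹ * (simpleWt S l i - (simpleWt S l i)⁻¹) := by
  have h := congrArg (· • w S l i) (H.rels S).EF
  simp only [sub_smul, mul_smul, smul_assoc, F_smul hl, E_smul hl, K_smul hl, Kinv_smul hl,
    smul_comm (H.E S) (β S l i), Nat.add_sub_cancel] at h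
  have h0 : β S l i • w S l (i - 1 + 1) = β S l i • w S l i := by
    rcases i with _ | i
    · simp [β, α]
    · simp
  rw [h0, ← sub_smul, ← sub_smul, smul_smul] at h
  exact smul_left_injective k (w_ne S hi) h

theorem F_pow_mem (hl : l ≤ S.n) {N : Submodule (H S) (V S l)} {i : ℕ} (hi : i < l)
    (h : w S l i ∈ N) : w S l 0 ∈ N := by
  induction i with
  | zero => exact h
  | succ i ih =>
    refine ih (by omega) ?_
    have h1 := N.smul_mem (H.F S) h
    rw [F_smul hl, Nat.add_sub_cancel] at h1
    have h2 := N.smul_of_tower_mem (β S l (i + 1))⁻¹ h1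
    rwa [smul_smul, inv_mul_cancel₀ (β_ne hl (by omega) hi), one_smul] at h2

theorem eq_top_of_w_zero_mem (hl : l ≤ S.n) {N : Submodule (H S) (V S l)} (h : w S l 0 ∈ N) :
    N = ⊤ := by
  refine eq_top_iff.mpr fun v _ => ?_
  rw [eq_sum v]
  refine N.sum_mem fun i _ => N.smul_of_tower_mem _ ?_
  have := N.smul_mem (H.E S ^ (i : ℕ)) h
  rwa [E_pow_smul hl, zero_add] at this

/-- `V_l` is simple for `1 ≤ l ≤ n`. -/
theorem isSimpleModule (h1 : 1 ≤ l) (hl : l ≤ S.n) : IsSimpleModule (H S) (V S l) := by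
  rw [isSimpleModule_iff_toSpanSingleton_surjective]
  refine ⟨⟨w S l 0, 0, w_ne S h1⟩, fun v hv => ?_⟩
  rw [← LinearMap.range_eq_top, LinearMap.range_toSpanSingleton]
  -- Some $1_g v$ is a nonzero multiple of a basis vector; $F$ brings it down to the lowest one, and
  -- $E$ then reaches all the others.
  obtain ⟨g, hg⟩ := H.exists_idem_smul_ne S hv
  obtain ⟨i, hi, -, d, hd, h⟩ := exists_eq_smul_of_weight hl hg (H.K_idem_smul S g v)
  refine eq_top_of_w_zero_mem hl (F_pow_mem hl hi ?_)
  rw [← one_smul k (w S l i), ← inv_mul_cancel₀ hd, mul_smul, ← h]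
  exact Submodule.smul_of_tower_mem _ _
    (Submodule.smul_mem _ _ (Submodule.mem_span_singleton_self v))

theorem eq_of_equiv {l' : ℕ} (e : V S l ≃ₗ[H S] V S l') : l = l' := by
  have := (e.restrictScalars k).finrank_eq
  change Module.finrank k (Fin l → k) = Module.finrank k (Fin l' → k) at this
  simpa using this

instance subsingleton_zero : Subsingleton (V S 0) := inferInstanceAs (Subsingleton (Fin 0 → k))

end V
end simple

/-! ### Lowest weight vectors and the classification of the simple modules with $K^n=1$. -/

section lowest
variable {k : Type v} [Field k] {S : Datum k}
  {Q : Type*} [AddCommGroup Q] [Module k Q] [Module (H S) Q] [IsScalarTower k (H S) Q]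

namespace V
variable {l : ℕ} {y : Q}

theorem K_smul_E_pow (hK : H.K S • y = S.q ^ (1 - l : ℤ) • y) (i : ℕ) :
    H.K S • H.E S ^ i • y = simpleWt S l i • H.E S ^ i • y := by
  rw [← mul_smul, (H.rels S).KE_pow, smul_assoc, mul_smul, hK, smul_comm (H.E S ^ i), smul_smul,
    simpleWt_eq, ← pow_mul, ← zpow_natCast, ← zpow_add₀ S.q_ne]
  congr 2
  omega

theorem Kinv_smul_of_weight {c : k} (hc : c ≠ 0) (hK : H.K S • y = c • y) :
    H.Kinv S • y = c⁻¹ • y := by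
  have h : H.Kinv S • H.K S • y = y := by rw [← mul_smul, (H.rels S).LK, one_smul]
  rw [hK, smul_comm] at h
  rw [← h, smul_smul, inv_mul_cancel₀ hc, one_smul, h]

/-- Commuting $F$ past one $E$ at a time gives the recursion `β_sub`. The case $i=l$ is included on
purpose: $\beta_l(l)=0$, so $E^ly$ is again killed by $F$. -/
theorem F_smul_E_pow (hl : l ≤ S.n) (hK : H.K S • y = S.q ^ (1 - l : ℤ) • y)
    (hF : H.F S • y = 0) {i : ℕ} (hi : i ≤ l) :
    H.F S • H.E S ^ i • y = β S l i • H.E S ^ (i - 1) • y := by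
  induction i with
  | zero => simp [hF, β, α]
  | succ i ih =>
    have h := congrArg (· • H.E S ^ i • y) (H.rels S).EF
    have hne : simpleWt S l i ≠ 0 := zpow_ne_zero _ S.q_ne
    simp only [sub_smul, mul_smul, smul_assoc, ih (by omega), K_smul_E_pow hK,
      Kinv_smul_of_weight hne (K_smul_E_pow hK i), smul_comm (H.E S) (β S l i)] at h
    have h0 : β S l i • H.E S • H.E S ^ (i - 1) • y = β S l i • H.E S ^ i • y := by
      rcases i with _ | i
      · simp [β, α]
      · simp [pow_succ', mul_smul]
    rw [h0, ← sub_smul, smul_smul (_⁻¹), ← β_sub hl hi, sub_smul, sub_right_inj] at h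
    rw [Nat.add_sub_cancel, pow_succ', mul_smul, h]

/-- A lowest weight vector of weight `q ^ (1 - l)` killed by `E ^ l` is the image of the lowest
weight vector of `V_l`. -/
theorem exists_lift (hl : l ≤ S.n) (hK : H.K S • y = S.q ^ (1 - l : ℤ) • y)
    (hF : H.F S • y = 0) (hE : H.E S ^ l • y = 0) :
    ∃ f : V S l →ₗ[H S] Q, ∀ i, f (w S l i) = H.E S ^ i • y := by
  let f : (Fin l → k) →ₗ[k] Q := (Pi.basisFun k (Fin l)).constr k fun i => H.E S ^ (i : ℕ) • y
  have hf : ∀ i, f (vec k l i) = H.E S ^ i • y := by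
    intro i
    -- Beyond the basis, for $i\ge l$, both sides vanish; this is where $E^ly=0$ is needed.
    by_cases h : i < l
    · have := vec_of_lt (k := k) ⟨i, h⟩
      simp only at this
      rw [this]
      exact Module.Basis.constr_basis _ _ _ _
    · obtain ⟨j, rfl⟩ := Nat.exists_eq_add_of_le (not_lt.mp h)
      rw [vec_of_le (not_lt.mp h), map_zero, add_comm, pow_add, mul_smul, hE, smul_zero]
  let g : V S l →ₗ[k] Q := f
  have hg : ∀ i, g (w S l i) = H.E S ^ i • y := hf
  have ext : ∀ x : H S, (∀ i < l, g (x • w S l i) = x • g (w S l i)) →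
      ∀ v, g (x • v) = x • g v := by
    intro x hx v
    obtain ⟨c, rfl⟩ : ∃ c : Fin l → k, v = ∑ i, c i • w S l i := ⟨v, eq_sum v⟩
    simp only [Finset.smul_sum, map_sum]
    refine Finset.sum_congr rfl fun i _ => ?_
    rw [smul_comm x, g.map_smul, g.map_smul, hx i i.2, smul_comm]
  refine ⟨linearMapOfGenerators g (ext _ fun i hi => ?_) (ext _ fun i hi => ?_)
    (ext _ fun i hi => ?_), hg⟩
  · rw [E_smul hl, hg, hg, pow_succ', mul_smul]
  · rw [F_smul hl, g.map_smul, hg, hg, F_smul_E_pow hl hK hF hi.le]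
  · rw [K_smul hl, g.map_smul, hg, K_smul_E_pow hK]

/-- The simple `H`-modules on which `K ^ n` acts trivially. -/
theorem exists_equiv_of_isSimpleModule [IsSimpleModule (H S) Q]
    (hn : ∀ v : Q, H.K S ^ S.n • v = v) :
    ∃ l, 1 ≤ l ∧ l ≤ S.n ∧ Nonempty (Q ≃ₗ[H S] V S l) := by
  have := IsSimpleModule.nontrivial (H S) Q
  obtain ⟨v, hv⟩ := exists_ne (0 : Q)
  obtain ⟨g, hg⟩ := H.exists_idem_smul_ne S hv
  have hy := H.K_idem_smul S g v
  generalize H.idem S g • v = y at hg hy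
  -- As $F$ is nilpotent, the last nonzero $F^jy$ is a lowest weight vector.
  have hFn : ∃ j, H.F S ^ j • y = 0 := ⟨S.n, by rw [(H.rels S).Fn, zero_smul]⟩
  classical
  obtain ⟨j, hj⟩ : ∃ j, Nat.find hFn = j + 1 := Nat.exists_eq_add_one_of_ne_zero fun h0 => by
    have := Nat.find_spec hFn
    rw [h0, pow_zero, one_smul] at this
    exact hg this
  have hne : H.F S ^ j • y ≠ 0 := Nat.find_min hFn (by omega)
  have hFz : H.F S • H.F S ^ j • y = 0 := by
    rw [← mul_smul, ← pow_succ', ← hj]; exact Nat.find_spec hFn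
  have hKz : H.K S • H.F S ^ j • y = ((S.q ^ (-2 : ℤ)) ^ j * S.ch (-g)) • H.F S ^ j • y := by
    rw [← mul_smul, (H.rels S).KF_pow, smul_assoc, mul_smul, hy, smul_comm (H.F S ^ j), smul_smul]
  generalize (S.q ^ (-2 : ℤ)) ^ j * S.ch (-g) = c at hKz
  generalize H.F S ^ j • y = z at hne hFz hKz
  -- Triviality of $K^n$ forces the weight to be an $n$-th root of unity, hence a power of $q$ and
  -- the lowest weight of some $V_l$.
  have hc : c ^ S.n = 1 := by
    have h1 := pow_smul_of_smul_eq hKz S.n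
    rw [hn] at h1
    exact smul_left_injective k hne (by simpa using h1.symm)
  obtain ⟨a, rfl⟩ := S.exists_zpow_eq hc
  obtain ⟨l, hl1, hl, hla⟩ := S.exists_lowest a
  rw [← hla] at hKz
  have hFE := fun i (hi : i ≤ l) => F_smul_E_pow hl hKz hFz hi
  -- Otherwise $E^lz$ generates the simple module. It is a weight vector killed by $F$, so monomials
  -- $E^aF^bK^c$ send it to 0 or to multiples of $E^{a+l}z$, all in the image of $E$ because
  -- $l\ge1$. Then $E$ would be surjective and nilpotent, forcing $z=0$.
  have hE : H.E S ^ l • z = 0 := by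
    by_contra hEz
    have hsurj := (isSimpleModule_iff_toSpanSingleton_surjective.mp ‹_›).2 _ hEz
    have hmem : ∀ x : H S, x • H.E S ^ l • z ∈
        LinearMap.range (Algebra.lsmul k k Q (H.E S) : Q →ₗ[k] Q) := by
      intro x
      have hx : x ∈ H.monoSpan S := H.monoSpan_eq_top S ▸ Submodule.mem_top
      induction hx using Submodule.span_induction with
      | mem x h =>
        obtain ⟨⟨a, b, c⟩, rfl⟩ := h
        simp only [mul_smul, pow_smul_of_smul_eq (K_smul_E_pow hKz l)]
        rcases b with _ | b
        · obtain ⟨d, rfl⟩ := Nat.exists_eq_add_of_le' hl1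
          refine ⟨simpleWt S (d + 1) (d + 1) ^ c • H.E S ^ a • H.E S ^ d • z, ?_⟩
          simp only [Algebra.lsmul_coe, pow_zero, smul_comm _ (simpleWt S _ _ ^ c),
            ← mul_smul, ← pow_succ', ← pow_add]
          rw [one_mul, ← pow_add, add_assoc]
        · simp [pow_succ, mul_smul, smul_comm (H.F S) (_ : k), hFE l le_rfl, β, α]
      | zero => simp
      | add x y _ _ h1 h2 => rw [add_smul]; exact add_mem h1 h2
      | smul c x _ h => rw [smul_assoc]; exact Submodule.smul_mem _ _ h
    have hpow : ∀ j (v : Q), ∃ u, H.E S ^ j • u = v := by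
      intro j
      induction j with
      | zero => exact fun v => ⟨v, by simp⟩
      | succ j ih =>
        intro v
        obtain ⟨x, rfl⟩ := hsurj v
        obtain ⟨u, hu⟩ := hmem x
        obtain ⟨u', rfl⟩ := ih u
        exact ⟨u', by rw [pow_succ', mul_smul]; exact hu⟩
    obtain ⟨u, hu⟩ := hpow S.n z
    exact hne (by rw [← hu, (H.rels S).En, zero_smul])
  obtain ⟨f, hf⟩ := exists_lift hl hKz hFz hE
  have := isSimpleModule hl1 hl
  have hf0 : f ≠ 0 := fun h0 => hne (by simpa [h0] using (hf 0).symm)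
  exact ⟨l, hl1, hl, ⟨(LinearEquiv.ofBijective f (LinearMap.bijective_of_ne_zero hf0)).symm⟩⟩

end V
end lowest

/-! ### Projectivity of $V_n$ and distinctness of the $P_l$. -/

section projective
variable {k : Type v} [Field k] (S : Datum k)

/-- $V_n$ splits off from the regular module: a lowest weight vector of $H$ gives a map $V_n\to H$,
and its composite with evaluation at the lowest vector of $V_n$ is a nonzero endomorphism of a
simple module. -/
theorem V.projective : Module.Projective (H S) (V S S.n) := by
  have h1 := S.n_pos
  obtain ⟨g, hg⟩ := S.exists_ch_neg (S.n * (1 - S.n))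
  rw [← S.q_zpow] at hg
  have hK : H.K S • H.idem S g = S.q ^ (1 - S.n : ℤ) • H.idem S g := by
    rw [← hg]; exact H.K_idem S g
  -- Equal powers of $E$ and $F$ preserve the weight $q^{1-n}$ of $1_g$, and $F^n=0$ makes $y$ a
  -- lowest weight vector. The condition $E^ny=0$ is automatic, which singles out $l=n$.
  let y : H S := H.F S ^ (S.n - 1) * H.E S ^ (S.n - 1) * H.idem S g
  have hy : H.K S • y = S.q ^ (1 - S.n : ℤ) • y := by
    simp only [y, smul_eq_mul, ← mul_assoc] at hK ⊢
    rw [(H.rels S).KF_pow, smul_mul_assoc, smul_mul_assoc, mul_assoc (_ ^ _) (H.K S),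
      (H.rels S).KE_pow, mul_smul_comm, smul_mul_assoc, smul_smul, ← mul_pow, ← zpow_natCast S.q 2,
      ← zpow_add₀ S.q_ne]
    simp [mul_assoc, hK]
  have hFy : H.F S • y = 0 := by
    simp only [y, smul_eq_mul, ← mul_assoc]
    rw [← pow_succ', Nat.sub_add_cancel h1, (H.rels S).Fn, zero_mul, zero_mul]
  have hEy : H.E S ^ S.n • y = 0 := by rw [(H.rels S).En, zero_smul]
  obtain ⟨f, hf⟩ := V.exists_lift le_rfl hy hFy hEy
  let p : H S →ₗ[H S] V S S.n := LinearMap.toSpanSingleton (H S) _ (V.w S S.n 0)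
  -- The scalar is a product of nonzero $\beta_i(n)$; for $j=n-1$ it is the factor by which the
  -- composite acts on the lowest vector.
  have hF : ∀ j ≤ S.n - 1, ∃ c : k, c ≠ 0 ∧
      H.F S ^ j • V.w S S.n (S.n - 1) = c • V.w S S.n (S.n - 1 - j) := by
    intro j hj
    induction j with
    | zero => exact ⟨1, one_ne_zero, by simp⟩
    | succ j ih =>
      obtain ⟨c, hc, h⟩ := ih (by omega)
      refine ⟨c * β S S.n (S.n - 1 - j), mul_ne_zero hc (V.β_ne le_rfl (by omega) (by omega)), ?_⟩
      rw [pow_succ', mul_smul, h, smul_comm, V.F_smul le_rfl, smul_smul]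
      congr 2
  obtain ⟨c, hc, h⟩ := hF (S.n - 1) le_rfl
  have hpf : p (f (V.w S S.n 0)) = c • V.w S S.n 0 := by
    have hw : H.idem S g • V.w S S.n 0 = V.w S S.n 0 := H.idem_smul_of_weight (by
      rw [V.K_smul le_rfl, hg, V.simpleWt_eq]; congr 2)
    simp only [hf, p, y, LinearMap.toSpanSingleton_apply, pow_zero, one_smul, mul_smul, hw]
    rw [V.E_pow_smul le_rfl, zero_add, h, Nat.sub_self]
  have := V.isSimpleModule h1 (le_refl S.n)
  have hb : Function.Bijective (p ∘ₗ f) := LinearMap.bijective_of_ne_zero fun h0 => by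
    have h2 := LinearMap.congr_fun h0 (V.w S S.n 0)
    rw [LinearMap.comp_apply, hpf, LinearMap.zero_apply, smul_eq_zero] at h2
    exact h2.elim hc (V.w_ne S h1)
  let e := LinearEquiv.ofBijective _ hb
  refine Module.Projective.of_split (f ∘ₗ e.symm.toLinearMap) p ?_
  exact LinearMap.ext fun v => e.apply_symm_apply v

theorem P_equiv_V : Nonempty (P S S.n ≃ₗ[H S] V S S.n) := by
  have := V.projective S
  exact (projCoverMap_isProjectiveCover (H S) (V S S.n)).nonempty_equiv IsProjectiveCover.refl

theorem P_zero_subsingleton : Subsingleton (P S 0) := by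
  have : Module.Projective (H S) (V S 0) := Module.Projective.of_free
  obtain ⟨e⟩ := (projCoverMap_isProjectiveCover (H S) (V S 0)).nonempty_equiv IsProjectiveCover.refl
  exact e.toEquiv.subsingleton

/-- A projective cover of a simple module has only one simple quotient, and the $V_l$ have different
dimensions. Index 0 is separate, since $P_0=0$ has no simple quotient. -/
theorem eq_of_P_equiv {l l' : ℕ} (hl : l ≤ S.n) (hl' : l' ≤ S.n)
    (h : Nonempty (P S l ≃ₗ[H S] P S l')) : l = l' := by
  obtain ⟨e⟩ := h
  have hπ := projCoverMap_isProjectiveCover (H S) (V S l)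
  have hπ' := projCoverMap_isProjectiveCover (H S) (V S l')
  have h0 := P_zero_subsingleton S
  rcases Nat.eq_zero_or_pos l with rfl | h1 <;> rcases Nat.eq_zero_or_pos l' with rfl | h1'
  · rfl
  · have : Subsingleton (P S l') := e.symm.toEquiv.subsingleton
    exact absurd (hπ'.surjective.subsingleton.elim _ _) (V.w_ne S h1')
  · have : Subsingleton (P S l) := e.toEquiv.subsingleton
    exact absurd (hπ.surjective.subsingleton.elim _ _) (V.w_ne S h1)
  · have := V.isSimpleModule h1 hl
    have := V.isSimpleModule h1' hl'
    obtain ⟨f⟩ := hπ.nonempty_equiv_of_isSimpleModule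
      (π' := projCoverMap (H S) (V S l') ∘ₗ e.toLinearMap) (hπ'.surjective.comp e.surjective)
    exact V.eq_of_equiv f

end projective

/-! ### Cyclic projective modules generated by a weight vector. -/

section cyclic
variable {k : Type v} [Field k] {S : Datum k}

/-- Moving $K^n$ past $E$ or $F$ costs $q^{\pm2n}=1$. Centrality spreads the action of $K^n$ on a
generator to the whole cyclic module. -/
theorem H.K_pow_comm (h : H S) : h * H.K S ^ S.n = H.K S ^ S.n * h := by
  have R := H.rels S
  have key : ∀ (x : H S) (c : k), H.K S * x = c • (x * H.K S) → c ^ S.n = 1 →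
      x * H.K S ^ S.n = H.K S ^ S.n * x := fun x c hx hc => by
    rw [H.pow_mul_of S hx, hc, one_smul]
  induction h using H.generators_induction S with
  | hs c => exact Algebra.commutes _ _
  | hE => exact key _ _ R.KE' (by rw [← pow_mul, mul_comm, pow_mul, S.q_pow_n, one_pow])
  | hF =>
    refine key _ _ R.KF' ?_
    rw [← zpow_natCast, ← zpow_mul, mul_comm, zpow_mul, zpow_natCast, S.q_pow_n, one_zpow]
  | hK => rw [← pow_succ, ← pow_succ']
  | hm x y hx hy => rw [mul_assoc, hy, ← mul_assoc, hx, mul_assoc]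
  | ha x y hx hy => rw [add_mul, mul_add, hx, hy]

variable {N : Type*} [AddCommGroup N] [Module k N] [Module (H S) N] [IsScalarTower k (H S) N]

/-- Decomposition of a projective module that is freely generated by a vector of weight `q ^ a`:
it is the sum of the `P_l` for which `q ^ a` is a weight of `V_l`. -/
theorem nonempty_equiv_pi_of_cyclic [Module.Projective (H S) N] {x : N}
    (hx : ∀ y : N, ∃ h : H S, h • x = y) {a : ℤ} (hK : H.K S • x = S.q ^ a • x)
    (hlift : ∀ l ≤ S.n, ∀ v : V S l, H.K S • v = S.q ^ a • v →
      ∃ f : N →ₗ[H S] V S l, f x = v)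
    {ι : Type*} [Finite ι] {f : ι → ℕ} (hinj : Function.Injective f) (hle : ∀ i, f i ≤ S.n)
    (hw : ∀ l, 1 ≤ l → l ≤ S.n →
      ((∃ i, f i = l) ↔ ∃ j < l, (S.n : ℤ) ∣ 2 * j + 1 - l - a)) :
    Nonempty (N ≃ₗ[H S] ∀ i, P S (f i)) := by
  classical
  have := Fintype.ofFinite ι
  -- Index 0 is allowed in the family; its factor is zero and takes the zero vector.
  have hv : ∀ i, ∃ v : V S (f i), H.K S • v = S.q ^ a • v ∧ (1 ≤ f i → v ≠ 0) := by
    intro i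
    rcases Nat.eq_zero_or_pos (f i) with h0 | h0
    · exact ⟨0, by simp, by omega⟩
    · obtain ⟨j, hj, hd⟩ := (hw _ h0 (hle i)).mp ⟨i, rfl⟩
      refine ⟨V.w S (f i) j, ?_, fun _ => V.w_ne S hj⟩
      rw [V.K_smul (hle i), V.simpleWt_eq, S.q_zpow_eq_iff.mpr hd]
  choose v hvK hv0 using hv
  choose π hπ using fun i => hlift (f i) (hle i) (v i) (hvK i)
  have hcov := IsProjectiveCover.pi fun i => projCoverMap_isProjectiveCover (H S) (V S (f i))
  refine IsProjectiveCover.nonempty_equiv (π := LinearMap.pi π) ⟨inferInstance, ?_, ?_⟩ hcov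
  · rw [← LinearMap.range_eq_top]
    -- If the image lay in a coatom $C$, the nonzero maps from the factors to the simple quotient by
    -- $C$ would be isomorphisms. As the $V_{f(i)}$ are pairwise non-isomorphic there is exactly one
    -- such map, and it does not kill the $i$-th coordinate $v_i\ne0$ of the image of $x$, a
    -- contradiction.
    by_contra hne
    obtain ⟨C, hC, hle'⟩ := (eq_top_or_exists_le_coatom _).resolve_left hne
    have hT : IsSimpleModule (H S) ((∀ i, V S (f i)) ⧸ C) := isSimpleModule_iff_isCoatom.mpr hC
    let θ := fun i => C.mkQ ∘ₗ LinearMap.single (H S) (fun i => V S (f i)) i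
    have hθ : ∀ y, C.mkQ y = ∑ i, θ i (y i) := by
      intro y
      conv_lhs => rw [← LinearMap.sum_single_apply (fun i => V S (f i)) y]
      rw [map_sum]; rfl
    obtain ⟨i, hi⟩ : ∃ i, θ i ≠ 0 := by
      by_contra! h0
      refine hC.1 (eq_top_iff.mpr fun y _ => ?_)
      rw [← Submodule.ker_mkQ C, LinearMap.mem_ker, hθ]
      exact Finset.sum_eq_zero fun i _ => by rw [h0]; rfl
    have hpos : ∀ i, θ i ≠ 0 → 1 ≤ f i := by
      intro i hi
      by_contra h0
      refine hi (LinearMap.ext fun y => ?_)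
      have : Subsingleton (V S (f i)) := by
        rw [show f i = 0 by omega]; infer_instance
      rw [Subsingleton.elim y 0, map_zero, map_zero]
    have hbij : ∀ i, θ i ≠ 0 → Function.Bijective (θ i) := by
      intro i hi
      have := V.isSimpleModule (hpos i hi) (hle i)
      exact LinearMap.bijective_of_ne_zero hi
    have huniq : ∀ j, j ≠ i → θ j = 0 := by
      intro j hj
      by_contra h0
      exact hj (hinj (V.eq_of_equiv (LinearEquiv.ofBijective _ (hbij j h0) ≪≫ₗ
        (LinearEquiv.ofBijective _ (hbij i hi)).symm)))
    have h1 : C.mkQ (LinearMap.pi π x) = 0 := by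
      rw [← LinearMap.mem_ker, Submodule.ker_mkQ]; exact hle' ⟨x, rfl⟩
    rw [hθ, Finset.sum_eq_single i (fun j _ hj => by rw [huniq j hj]; rfl) (by simp)] at h1
    rw [LinearMap.pi_apply, hπ, ← map_zero (θ i)] at h1
    exact hv0 i (hpos i hi) ((hbij i hi).1 h1)
  · intro D hD
    -- Enlarge $D$ to a coatom $C$. The quotient $N/C$ is some $V_l$ in which $x$ has nonzero image
    -- of weight $q^a$, so $l=f(i)$. Multiplicity one makes the quotient map proportional to `π i`
    -- on the generator $x$, so $C$ contains the kernel of the whole map, which together with $D$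
    -- was everything.
    by_contra hne
    have : Module.Finite (H S) N := Module.Finite.of_surjective
      (LinearMap.toSpanSingleton (H S) N x) hx
    obtain ⟨C, hC, hle'⟩ := (eq_top_or_exists_le_coatom D).resolve_left hne
    have hT : IsSimpleModule (H S) (N ⧸ C) := isSimpleModule_iff_isCoatom.mpr hC
    have hKx : H.K S ^ S.n • x = x := by
      rw [pow_smul_of_smul_eq hK, ← zpow_natCast, ← zpow_mul, mul_comm, zpow_mul, zpow_natCast,
        S.q_pow_n, one_zpow, one_smul]
    have hKn : ∀ y : N ⧸ C, H.K S ^ S.n • y = y := by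
      intro y
      obtain ⟨y, rfl⟩ := C.mkQ_surjective y
      obtain ⟨h, rfl⟩ := hx y
      rw [← map_smul, ← mul_smul, ← H.K_pow_comm, mul_smul, hKx]
    obtain ⟨l, hl1, hl, ⟨e⟩⟩ := V.exists_equiv_of_isSimpleModule hKn
    let φ := e.toLinearMap ∘ₗ C.mkQ
    have hφ : LinearMap.ker φ = C := by
      rw [LinearEquiv.ker_comp, Submodule.ker_mkQ]
    have hφx : φ x ≠ 0 := fun h0 => hC.1 (eq_top_iff.mpr fun y _ => by
      obtain ⟨h, rfl⟩ := hx y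
      rw [← hφ, LinearMap.mem_ker, map_smul, h0, smul_zero])
    have hφK : H.K S • φ x = S.q ^ a • φ x := by
      rw [← map_smul, hK, LinearMap.map_smul_of_tower]
    obtain ⟨j, hj, hwj, d, -, hd⟩ := V.exists_eq_smul_of_weight hl hφx hφK
    obtain ⟨i, rfl⟩ := (hw l hl1 hl).mpr ⟨j, hj, by
      rw [V.simpleWt_eq, S.q_zpow_eq_iff] at hwj; exact hwj⟩
    obtain ⟨j', hj', hwj', d', hd', hv'⟩ :=
      V.exists_eq_smul_of_weight hl (hv0 i hl1) (hvK i)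
    obtain rfl := V.simpleWt_injOn hl hj hj' (hwj.trans hwj'.symm)
    have hφπ : φ x = (d * d'⁻¹) • π i x := by
      rw [hπ, hv', hd, smul_smul, inv_mul_cancel_right₀ hd']
    refine hC.1 (top_le_iff.mp (hD ▸ sup_le hle' fun y hy => ?_))
    have hy' : π i y = 0 := congrFun (LinearMap.mem_ker.mp hy) i
    obtain ⟨h, rfl⟩ := hx y
    rw [map_smul] at hy'
    rw [← hφ, LinearMap.mem_ker, map_smul, hφπ, smul_comm, hy', smul_zero]

/-- A module of dimension at least `n ^ 2` generated by a vector of weight `q ^ a` is the sum of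
the `P_l` for which `q ^ a` is a weight of `V_l`. -/
theorem nonempty_equiv_pi_of_finrank [FiniteDimensional k N] {x : N}
    (hx : ∀ y : N, ∃ h : H S, h • x = y)
    {a : ℤ} (hK : H.K S • x = S.q ^ a • x) (hN : S.n * S.n ≤ Module.finrank k N)
    {ι : Type*} [Finite ι] {f : ι → ℕ} (hinj : Function.Injective f) (hle : ∀ i, f i ≤ S.n)
    (hw : ∀ l, 1 ≤ l → l ≤ S.n →
      ((∃ i, f i = l) ↔ ∃ j < l, (S.n : ℤ) ∣ 2 * j + 1 - l - a)) :
    Nonempty (N ≃ₗ[H S] ∀ i, P S (f i)) := by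
  obtain ⟨g, hg⟩ := S.exists_ch_neg (S.n * a)
  rw [← S.q_zpow] at hg
  set e := H.idem S g with he
  have hee : e * e = e := by classical simp [he, H.idem_mul]
  have hKe : H.K S • e = S.q ^ a • e := by rw [← hg]; exact H.K_idem S g
  let I : Submodule (H S) (H S) := Submodule.span (H S) {e}
  have hI : ∀ y ∈ I, y * e = y := by
    intro y hy
    obtain ⟨h, rfl⟩ := Submodule.mem_span_singleton.mp hy
    rw [smul_eq_mul, mul_assoc, hee]
  let x₀ : I := ⟨e, Submodule.mem_span_singleton_self e⟩
  have hx₀ : ∀ y : I, ∃ h : H S, h • x₀ = y := fun y =>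
    ⟨y, Subtype.ext (hI y y.2)⟩
  have hproj : Module.Projective (H S) I := by
    refine Module.Projective.of_split I.subtype
      ((LinearMap.toSpanSingleton (H S) (H S) e).codRestrict I fun y =>
        Submodule.smul_mem _ _ (Submodule.mem_span_singleton_self e)) ?_
    exact LinearMap.ext fun y => Subtype.ext (hI y y.2)
  have hx₀K : H.K S • x₀ = S.q ^ a • x₀ := Subtype.ext hKe
  -- In a monomial $E^bF^cK^d$ the power of $K$ acts on the generator by a scalar, so only the
  -- exponents $b,c<n$ matter.
  have hspan : (⊤ : Submodule k I) ≤ Submodule.span k (Set.range fun p : Fin S.n × Fin S.n =>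
      (H.E S ^ (p.1 : ℕ) * H.F S ^ (p.2 : ℕ)) • x₀) := by
    rintro y -
    obtain ⟨h, rfl⟩ := hx₀ y
    have hh : h ∈ H.monoSpan S := H.monoSpan_eq_top S ▸ Submodule.mem_top
    induction hh using Submodule.span_induction with
    | mem h hm =>
      obtain ⟨⟨b, c, d⟩, rfl⟩ := hm
      simp only [mul_smul _ (H.K S ^ d), pow_smul_of_smul_eq hx₀K]
      rw [smul_comm]
      refine Submodule.smul_mem _ _ ?_
      by_cases hb : b < S.n
      · by_cases hc : c < S.n
        · exact Submodule.subset_span ⟨(⟨b, hb⟩, ⟨c, hc⟩), rfl⟩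
        · simp [pow_eq_zero_of_le (not_lt.mp hc) (H.rels S).Fn]
      · simp [pow_eq_zero_of_le (not_lt.mp hb) (H.rels S).En]
    | zero => simp
    | add y z _ _ h1 h2 => rw [add_smul]; exact add_mem h1 h2
    | smul c y _ h => rw [smul_assoc]; exact Submodule.smul_mem _ _ h
  have hfin : Module.finrank k I ≤ S.n * S.n := by
    have h1 := finrank_range_le_card (R := k) fun p : Fin S.n × Fin S.n =>
      (H.E S ^ (p.1 : ℕ) * H.F S ^ (p.2 : ℕ)) • x₀
    rw [Set.finrank, top_le_iff.mp hspan, finrank_top] at h1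
    simpa using h1
  have hex : e • x = x := H.idem_smul_of_weight (by rw [hg]; exact hK)
  let ψ : I →ₗ[H S] N := LinearMap.toSpanSingleton (H S) N x ∘ₗ I.subtype
  have hψ : Function.Surjective ψ := by
    intro y
    obtain ⟨h, rfl⟩ := hx y
    refine ⟨h • x₀, ?_⟩
    change (h * e) • x = h • x
    rw [mul_smul, hex]
  have : FiniteDimensional k I := inferInstanceAs (FiniteDimensional k (I.restrictScalars k))
  -- The ideal has dimension at most $n^2$ and surjects onto a module of dimension at least $n^2$.
  have hinjψ : Function.Injective (ψ.restrictScalars k) := by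
    refine (LinearMap.injective_iff_surjective_of_finrank_eq_finrank ?_).mpr hψ
    exact le_antisymm (hfin.trans hN) (LinearMap.finrank_le_finrank_of_surjective
      (f := ψ.restrictScalars k) hψ)
  obtain ⟨E⟩ := nonempty_equiv_pi_of_cyclic hx₀ hx₀K (fun l _ v hv =>
    ⟨LinearMap.toSpanSingleton (H S) _ v ∘ₗ I.subtype,
      H.idem_smul_of_weight (by rw [hg]; exact hv)⟩) hinj hle hw
  exact ⟨(LinearEquiv.ofBijective ψ ⟨hinjψ, hψ⟩).symm ≪≫ₗ E⟩

end cyclic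

/-! ### The tensor product: generator, weight, dimension. -/

section tensor
variable {k : Type v} [Field k] (S : Datum k)

namespace VV

/-- The basis vectors of `𝐕(t, r)`, indexed from `0`; zero for `i ≥ n`. -/
def w (t : ℕ) (r : ℤ) (i : ℕ) : VV S t r := vec k S.n i

variable {S} (t : ℕ) (r : ℤ)

theorem w_of_le {i : ℕ} (h : S.n ≤ i) : w S t r i = 0 := vec_of_le h

theorem E_smul (i : ℕ) : H.E S • w S t r i = w S t r (i + 1) := by
  rw [VV_smul, bigRep, H.E, H.lift_gen]
  exact opE_vec S.n i

theorem F_smul (i : ℕ) : H.F S • w S t r i = γ S t r i • w S t r (i - 1) := by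
  rw [VV_smul, bigRep, H.F, H.lift_gen]
  refine opF_vec (by simp [γ]) ?_ i
  have h : ∀ s : ℤ, S.q ^ (s * (r + S.n)) = S.q ^ (s * r) := fun s =>
    S.q_zpow_eq_iff.mpr ⟨s, by ring⟩
  simp only [γ, h, sub_self, zero_div, mul_zero]

theorem K_smul (i : ℕ) : H.K S • w S t r i = bigWt S t r i • w S t r i := by
  rw [VV_smul, bigRep, H.K, H.lift_gen]
  exact opK_vec S.n (bigWt S t r) i

theorem eq_sum (v : VV S t r) : ∃ c : Fin S.n → k, v = ∑ i, c i • w S t r i := by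
  have h : ∀ v : Fin S.n → k, v = ∑ i : Fin S.n, v i • vec k S.n i := fun v => by
    simp only [vec_of_lt]
    exact ((Pi.basisFun k (Fin S.n)).sum_repr v).symm
  exact ⟨v, h v⟩

theorem exists_idem_smul (i : ℕ) : ∃ g, H.idem S g • w S t r i = w S t r i := by
  obtain ⟨g, hg⟩ := S.exists_ch_neg (t + S.n * (2 * (r + i)))
  refine ⟨g, H.idem_smul_of_weight ?_⟩
  rw [K_smul, hg, bigWt, S.q_zpow, zpow_add₀ S.ξ_ne, zpow_natCast]

-- Up to a nonzero factor, $\gamma_j$ is $(q^{2j}-1)(q^2-\mathbf q^{2t}q^{4r+2j})$. The first factor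
-- survives because $0<j<n$, the second because $n$ does not divide $2t$.
variable {t} in
theorem γ_ne (ht : 1 ≤ t) (ht' : t < S.n) {j : ℕ} (hj : 0 < j) (hj' : j < S.n) :
    γ S t r j ≠ 0 := by
  have hq := S.q_ne
  have hξ : S.ξ ^ t ≠ 0 := pow_ne_zero _ S.ξ_ne
  have h1 : S.q ^ (2 * j : ℤ) ≠ 1 := by
    rw [← zpow_zero S.q, Ne, S.q_zpow_eq_iff]
    intro h
    have h2 := Int.le_of_dvd (by omega) (S.dvd_of_dvd_two_mul (x := j) (by simpa using h))
    omega
  have h2 : S.ξ ^ t * S.ξ ^ t * S.q ^ (2 * r) * S.q ^ (2 * r) * S.q ^ (2 * j : ℤ) ≠ S.q ^ 2 := by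
    intro h
    rw [← zpow_natCast S.q, S.q_zpow, S.q_zpow, S.q_zpow, ← zpow_natCast, ← zpow_add₀ S.ξ_ne,
      ← zpow_add₀ S.ξ_ne, ← zpow_add₀ S.ξ_ne, ← zpow_add₀ S.ξ_ne, ← div_eq_one_iff_eq
      (zpow_ne_zero _ S.ξ_ne), ← zpow_sub₀ S.ξ_ne, S.ξ_prim.zpow_eq_one_iff_dvd] at h
    -- Written as powers of $\mathbf q$, all exponents coming from $q$ are multiples of $n$, so
    -- reducing modulo $n$ leaves only $2t$.
    have h3 : (S.n : ℤ) ∣ S.m := ⟨S.n, by rw [Datum.m]; push_cast; ring⟩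
    have h4 := h3.trans h
    have h5 : (S.n : ℤ) ∣ 2 * t := by
      have h6 := dvd_sub h4 (Dvd.intro (4 * r + 2 * j - 2) rfl)
      have e : (2 * t : ℤ) = t + t + S.n * (2 * r) + S.n * (2 * r) + S.n * (2 * j)
          - S.n * (2 : ℕ) - S.n * (4 * r + 2 * j - 2) := by push_cast; ring
      rwa [e]
    have := Int.le_of_dvd (by omega) (S.dvd_of_dvd_two_mul h5)
    omega
  have e1 : ∀ s : ℤ, S.q ^ (-2 * s) = (S.q ^ (2 * s))⁻¹ := by
    intro s; rw [← zpow_neg]; congr 1; ring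
  have e2 : S.q ^ (2 * (r + j)) = S.q ^ (2 * r) * S.q ^ (2 * j : ℤ) := by
    rw [← zpow_add₀ hq]; congr 1; ring
  have hx : S.q ^ (2 * r) ≠ 0 := zpow_ne_zero _ hq
  have hy : S.q ^ (2 * j : ℤ) ≠ 0 := zpow_ne_zero _ hq
  have hq2 := sub_ne_zero.mpr S.q2_ne_one
  have e3 : 1 - S.q ^ (-2 : ℤ) = (S.q ^ 2 - 1) / S.q ^ 2 := by
    rw [zpow_neg]; norm_cast; field_simp
  have e4 : 1 - S.q ^ 2 = -(S.q ^ 2 - 1) := by ring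
  rw [γ]
  refine mul_ne_zero (one_div_ne_zero S.q_sub_inv_ne) fun h => ?_
  simp only [e1, e2, e4, zpow_neg, zpow_natCast] at h
  generalize S.q ^ (2 * r) = x at *
  generalize S.q ^ (2 * j : ℤ) = y at *
  generalize S.ξ ^ t = z at *
  field_simp at h
  have h3 : (y - 1) * (S.q ^ 2 - z * z * x * x * y) = 0 := by
    linear_combination h
  exact (mul_ne_zero (sub_ne_zero.mpr h1) (sub_ne_zero.mpr h2.symm)) h3

end VV

namespace Tens
variable {S} {M N : Type*} [AddCommGroup M] [Module k M] [Module (H S) M]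
  [IsScalarTower k (H S) M] [AddCommGroup N] [Module k N] [Module (H S) N]
  [IsScalarTower k (H S) N]

variable (S) in
/-- Pure tensors in `M ⊗ N`. -/
def tmul : M →ₗ[k] N →ₗ[k] Tens S M N := TensorProduct.mk k M N

theorem comul_E : H.comul S (H.E S) = H.comulE S := by
  rw [H.comul, H.E, H.lift_gen]; rfl

theorem comul_F : H.comul S (H.F S) = H.comulF S := by
  rw [H.comul, H.F, H.lift_gen]; rfl

theorem comul_K : H.comul S (H.K S) = H.K S ⊗ₜ[k] H.K S := by
  exact H.lift_gen S (H.comul_rel S) Gen.K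

variable (M N) in
/-- The action of `H ⊗ H` on `M ⊗ N`. -/
def outerRep : H S ⊗[k] H S →ₐ[k] Module.End k (M ⊗[k] N) :=
  (Module.endTensorEndAlgHom (R := k) (S := k) (A := k) (M := M) (N := N)).comp
    (Algebra.TensorProduct.map (Algebra.lsmul k k M : H S →ₐ[k] Module.End k M)
      (Algebra.lsmul k k N : H S →ₐ[k] Module.End k N))

theorem outerRep_tmul (a b : H S) (x : M) (y : N) :
    outerRep M N (a ⊗ₜ[k] b) (x ⊗ₜ[k] y) = (a • x) ⊗ₜ[k] (b • y) := rfl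

theorem smul_tmul (h : H S) (x : M) (y : N) :
    h • tmul S x y = outerRep M N (H.comul S h) (x ⊗ₜ[k] y) := rfl

theorem K_smul (x : M) (y : N) :
    H.K S • tmul S x y = tmul S (H.K S • x) (H.K S • y) := by
  rw [smul_tmul, comul_K, outerRep_tmul]; rfl

omit [Module k M] [IsScalarTower k (H S) M] in
theorem idem_smul_of_ne {f g : ZMod S.m} {x : M} (hx : H.idem S f • x = x) (h : g ≠ f) :
    H.idem S g • x = 0 := by
  rw [← hx, ← mul_smul, H.idem_mul, if_neg h, zero_smul]

/-- On a tensor of homogeneous vectors only one pair of idempotents survives. The double sums in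
$\Delta(E)$ and $\Delta(F)$ thus contribute a single scalar. -/
theorem outerRep_diag {f g : ZMod S.m} {x : M} {y : N} (hx : H.idem S f • x = x)
    (hy : H.idem S g • y = y) (c : ZMod S.m → ZMod S.m → k) :
    outerRep M N (H.diag S c) (x ⊗ₜ[k] y) = c f g • (x ⊗ₜ[k] y) := by
  rw [H.diag, map_sum, LinearMap.sum_apply, Finset.sum_eq_single f, map_sum, LinearMap.sum_apply,
    Finset.sum_eq_single g]
  · rw [map_smul, LinearMap.smul_apply, outerRep_tmul, hx, hy]
  · intro b _ hb
    rw [map_smul, LinearMap.smul_apply, outerRep_tmul, idem_smul_of_ne hy hb,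
      TensorProduct.tmul_zero, smul_zero]
  · simp
  · intro a _ ha
    rw [map_sum, LinearMap.sum_apply]
    refine Finset.sum_eq_zero fun b _ => ?_
    rw [map_smul, LinearMap.smul_apply, outerRep_tmul, idem_smul_of_ne hx ha,
      TensorProduct.zero_tmul, smul_zero]
  · simp

theorem E_smul {f g : ZMod S.m} {x : M} {y : N} (hx : H.idem S f • x = x)
    (hy : H.idem S g • y = y) :
    H.E S • tmul S x y =
      S.Φ1 f g • tmul S (H.E S • x) y + tmul S (H.K S • x) (H.E S • y) := by
  rw [smul_tmul, comul_E, H.comulE_eq, map_add, LinearMap.add_apply, map_mul, map_mul,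
    Module.End.mul_apply, Module.End.mul_apply, outerRep_diag hx hy, map_smul, outerRep_tmul,
    outerRep_tmul, outerRep_tmul, one_smul, one_smul, one_smul]
  rfl

theorem F_smul {f g : ZMod S.m} {x : M} {y : N} (hx : H.idem S f • x = x)
    (hy : H.idem S g • y = y) :
    H.F S • tmul S x y = S.Ψ f g • tmul S (H.F S • x) y + tmul S x (H.F S • y) := by
  rw [smul_tmul, comul_F, H.comulF_eq, map_add, LinearMap.add_apply, map_mul,
    Module.End.mul_apply, outerRep_diag hx hy, map_smul, outerRep_tmul, outerRep_tmul, one_smul,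
    one_smul]
  rfl

instance finiteDimensional [FiniteDimensional k M] [FiniteDimensional k N] :
    FiniteDimensional k (Tens S M N) :=
  inferInstanceAs (FiniteDimensional k (M ⊗[k] N))

end Tens

variable {S}

theorem Datum.Φ1_ne (f g : ZMod S.m) : S.Φ1 f g ≠ 0 := zpow_ne_zero _ S.ζ_ne

/-- `𝐕(t, r) ⊗ 𝐕(t', r')` is generated by the product of the lowest weight vector and the highest
weight vector. -/
theorem tens_generated {t t' : ℕ} (ht : 1 ≤ t') (ht' : t' < S.n) (r r' : ℤ)
    (y : Tens S (VV S t r) (VV S t' r')) :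
    ∃ h : H S, h • Tens.tmul S (VV.w S t r 0) (VV.w S t' r' (S.n - 1)) = y := by
  set x := Tens.tmul S (VV.w S t r 0) (VV.w S t' r' (S.n - 1)) with hx
  let N : Submodule (H S) (Tens S (VV S t r) (VV S t' r')) := Submodule.span (H S) {x}
  -- $F$ annihilates the first leg, so $\Delta(F)$ simply lowers the second, with nonzero
  -- coefficient $\gamma$.
  have hlow : ∀ j < S.n,
      Tens.tmul S (VV.w S t r 0) (VV.w S t' r' (S.n - 1 - j)) ∈ N := by
    intro j hj
    induction j with
    | zero => exact Submodule.mem_span_singleton_self _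
    | succ j ih =>
      obtain ⟨f, hf⟩ := VV.exists_idem_smul (S := S) t r 0
      obtain ⟨g, hg⟩ := VV.exists_idem_smul (S := S) t' r' (S.n - 1 - j)
      have h1 := N.smul_mem (H.F S) (ih (by omega))
      have h0 : γ S t r 0 = 0 := by simp [γ]
      have h2 := VV.γ_ne (S := S) r' ht ht' (j := S.n - 1 - j) (by omega) (by omega)
      rw [Tens.F_smul hf hg, VV.F_smul, VV.F_smul, h0, zero_smul] at h1
      have h3 := N.smul_of_tower_mem (γ S t' r' (S.n - 1 - j))⁻¹ h1
      rwa [map_zero, LinearMap.zero_apply, smul_zero, zero_add, map_smul, smul_smul,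
        inv_mul_cancel₀ h2, one_smul, Nat.sub_sub] at h3
  -- Applying $E$ to $w_i\otimes w'_j$ gives a nonzero multiple of $w_{i+1}\otimes w'_j$ plus a
  -- multiple of $w_i\otimes w'_{j+1}$, which the induction on $i$ already covers for every $j$.
  have hall : ∀ i j, Tens.tmul S (VV.w S t r i) (VV.w S t' r' j) ∈ N := by
    intro i
    induction i with
    | zero =>
      intro j
      by_cases hj : j < S.n
      · convert hlow (S.n - 1 - j) (by omega) using 3
        omega
      · rw [VV.w_of_le _ _ (not_lt.mp hj), map_zero]
        exact N.zero_mem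
    | succ i ih =>
      intro j
      obtain ⟨f, hf⟩ := VV.exists_idem_smul (S := S) t r i
      obtain ⟨g, hg⟩ := VV.exists_idem_smul (S := S) t' r' j
      have h1 := N.smul_mem (H.E S) (ih j)
      rw [Tens.E_smul hf hg, VV.E_smul, VV.E_smul, VV.K_smul, map_smul, LinearMap.smul_apply] at h1
      have h2 := (N.add_mem_iff_left (N.smul_of_tower_mem _ (ih (j + 1)))).mp h1
      have h3 := N.smul_of_tower_mem (S.Φ1 f g)⁻¹ h2
      rwa [smul_smul, inv_mul_cancel₀ (S.Φ1_ne f g), one_smul] at h3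
  have htop : ∀ y, y ∈ N := by
    intro y
    induction y using TensorProduct.induction_on with
    | zero => exact N.zero_mem
    | add y z hy hz => exact N.add_mem hy hz
    | tmul a b =>
      change Tens.tmul S a b ∈ N
      obtain ⟨c, rfl⟩ := VV.eq_sum t r a
      obtain ⟨d, rfl⟩ := VV.eq_sum t' r' b
      simp only [map_sum, map_smul, LinearMap.sum_apply, LinearMap.smul_apply]
      exact N.sum_mem fun i _ => N.smul_of_tower_mem _ (N.sum_mem fun j _ =>
        N.smul_of_tower_mem _ (hall j i))
  exact Submodule.mem_span_singleton.mp (htop y)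

/-- The condition $t+t'=n$ gives $\mathbf q^{t+t'}=q$, so the weight is
$q^{1+2(r+r')+2(n-1)}=q^{2u-1}$. -/
theorem tens_K_smul {t t' : ℕ} (htt' : t + t' = S.n) (r r' : ℤ) {u : ℤ}
    (hr : r + r' ≡ u [ZMOD S.n]) :
    H.K S • Tens.tmul S (VV.w S t r 0) (VV.w S t' r' (S.n - 1)) =
      S.q ^ (2 * u - 1) • Tens.tmul S (VV.w S t r 0) (VV.w S t' r' (S.n - 1)) := by
  rw [Tens.K_smul, VV.K_smul, VV.K_smul, map_smul, map_smul, LinearMap.smul_apply, smul_smul]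
  congr 1
  have hn : ((S.n - 1 : ℕ) : ℤ) = S.n - 1 := by have := S.n_pos; omega
  have h1 : S.ξ ^ t' * S.ξ ^ t = S.q ^ (1 : ℤ) := by
    rw [← pow_add, add_comm, htt', zpow_one]; rfl
  rw [bigWt, bigWt, mul_mul_mul_comm, h1, ← zpow_add₀ S.q_ne, ← zpow_add₀ S.q_ne,
    S.q_zpow_eq_iff, hn]
  obtain ⟨c, hc⟩ := hr.dvd
  refine ⟨2 - 2 * c, ?_⟩
  push_cast
  linear_combination (-2) * hc

theorem tens_finrank (t t' : ℕ) (r r' : ℤ) :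
    Module.finrank k (Tens S (VV S t r) (VV S t' r')) = S.n * S.n := by
  change Module.finrank k ((Fin S.n → k) ⊗[k] (Fin S.n → k)) = _
  simp

/-- The tensor product is the sum of the `P_l` for which `q ^ (2 u - 1)` is a weight of `V_l`. -/
theorem tens_nonempty_equiv_pi {t t' : ℕ} (ht : 1 ≤ t') (ht' : t' < S.n) (htt' : t + t' = S.n)
    {r r' u : ℤ} (hr : r + r' ≡ u [ZMOD S.n]) {ι : Type*} [Finite ι] {f : ι → ℕ}
    (hinj : Function.Injective f) (hle : ∀ i, f i ≤ S.n)
    (hw : ∀ l, 1 ≤ l → l ≤ S.n →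
      ((∃ i, f i = l) ↔ ∃ j < l, (S.n : ℤ) ∣ 2 * j + 1 - l - (2 * u - 1))) :
    Nonempty (Tens S (VV S t r) (VV S t' r') ≃ₗ[H S] ∀ i, P S (f i)) :=
  nonempty_equiv_pi_of_finrank (tens_generated ht ht' r r') (tens_K_smul htt' r r' hr)
    (tens_finrank t t' r r').ge hinj hle hw

end tensor

/-! ### Rewriting finite products as direct sums. -/

section packaging
variable {A : Type*} [Ring A] {ι₁ ι₂ : Type*} [Fintype ι₁] [Fintype ι₂]

/-- A product over a disjoint union is the product of two direct sums. -/
def piSumEquivDirectSum [DecidableEq ι₁] [DecidableEq ι₂] (M : ι₁ ⊕ ι₂ → Type*)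
    [∀ i, AddCommGroup (M i)] [∀ i, Module A (M i)] :
    (∀ i, M i) ≃ₗ[A] (⨁ i, M (Sum.inl i)) × (⨁ i, M (Sum.inr i)) :=
  LinearEquiv.sumPiEquivProdPi A ι₁ ι₂ M ≪≫ₗ
    (DirectSum.linearEquivFunOnFintype A ι₁ fun i => M (Sum.inl i)).symm.prodCongr
      (DirectSum.linearEquivFunOnFintype A ι₂ fun i => M (Sum.inr i)).symm

/-- A product over a disjoint union with an added point. -/
def piSumUnitEquivDirectSum [DecidableEq ι₁] [DecidableEq ι₂] (M : ι₁ ⊕ (Unit ⊕ ι₂) → Type*)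
    [∀ i, AddCommGroup (M i)] [∀ i, Module A (M i)] :
    (∀ i, M i) ≃ₗ[A] (⨁ i, M (Sum.inl i)) × M (Sum.inr (Sum.inl ())) ×
      (⨁ i, M (Sum.inr (Sum.inr i))) :=
  LinearEquiv.sumPiEquivProdPi A ι₁ _ M ≪≫ₗ
    (DirectSum.linearEquivFunOnFintype A ι₁ fun i => M (Sum.inl i)).symm.prodCongr
      (LinearEquiv.sumPiEquivProdPi A Unit ι₂ (fun i => M (Sum.inr i)) ≪≫ₗ
        (LinearEquiv.piUnique A fun i : Unit => M (Sum.inr (Sum.inl i))).prodCongr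
          (DirectSum.linearEquivFunOnFintype A ι₂ fun i => M (Sum.inr (Sum.inr i))).symm)

end packaging

/-! ### Solving the weight congruence in the two ranges of $u$. -/

section decomposition
variable {k : Type v} [Field k] (S : Datum k) {t t' : ℕ} (ht : 1 ≤ t') (ht' : t' < S.n)
  (htt' : t + t' = S.n) {r r' : ℤ} {u : ℕ} (hr : r + r' ≡ (u : ℤ) [ZMOD (S.n : ℤ)])
include ht ht' htt' hr

/-- Write $2j+1-l-(2u-1)=nc$, that is $l=2(j+1-u)-nc$. The value $c=0$ gives the even $l$, and
$c=-1$ the odd ones, with $l=n$ at $j+1=u$. When $u=0$ the index $l=n$ comes from $c=1$, $j=n-1$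
instead. Parity and $n-2u+2j<n$ keep the three families disjoint. -/
theorem tens_decomposition_of_le (hu : u ≤ (S.n - 1) / 2) :
    Nonempty (Tens S (VV S t r) (VV S t' r') ≃ₗ[H S]
      (⨁ j : Finset.Icc u ((S.n - 1) / 2), P S (2 * j)) × V S S.n ×
        (⨁ j : Finset.Icc 1 (u - 1), P S (S.n - 2 * u + 2 * j))) := by
  obtain ⟨h, hn⟩ := S.n_odd
  let f : Finset.Icc u ((S.n - 1) / 2) ⊕ (Unit ⊕ Finset.Icc 1 (u - 1)) → ℕ :=
    Sum.elim (fun j => 2 * j) (Sum.elim (fun _ => S.n) fun j => S.n - 2 * u + 2 * j)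
  have hinj : Function.Injective f := by
    rintro (⟨a, ha⟩ | _ | ⟨a, ha⟩) (⟨b, hb⟩ | _ | ⟨b, hb⟩) hab <;>
      (try have ha' := Finset.mem_Icc.mp ha) <;> (try have hb' := Finset.mem_Icc.mp hb) <;>
      simp only [f, Sum.elim_inl, Sum.elim_inr, Sum.inl.injEq, Sum.inr.injEq,
        Subtype.mk.injEq, reduceCtorEq] at hab ⊢ <;> omega
  have hle : ∀ i, f i ≤ S.n := by
    rintro (⟨a, ha⟩ | _ | ⟨a, ha⟩) <;>
      (try have ha' := Finset.mem_Icc.mp ha) <;>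
      simp only [f, Sum.elim_inl, Sum.elim_inr] <;> omega
  obtain ⟨e⟩ := tens_nonempty_equiv_pi ht ht' htt' hr hinj hle (fun l hl1 hl => by
    constructor
    · rintro ⟨⟨a, ha⟩ | _ | ⟨a, ha⟩, rfl⟩ <;>
        (try have ha' := Finset.mem_Icc.mp ha) <;>
        simp only [f, Sum.elim_inl, Sum.elim_inr] at hl1 hl ⊢
      · exact ⟨a + u - 1, by omega, 0, by omega⟩
      · rcases Nat.eq_zero_or_pos u with rfl | hu0
        · exact ⟨S.n - 1, by omega, 1, by omega⟩
        · exact ⟨u - 1, by omega, -1, by omega⟩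
      · exact ⟨a - 1, by omega, -1, by omega⟩
    · rintro ⟨j, hj, c, hc⟩
      -- The bounds $0\le j<l\le n$ leave only $c=-1,0,1$.
      have h1 : c < 2 := by
        by_contra h0
        have := mul_le_mul_of_nonneg_left (show 2 ≤ c by omega) (Int.natCast_nonneg S.n)
        omega
      have h2 : -2 < c := by
        by_contra h0
        have := mul_le_mul_of_nonneg_left (show c ≤ -2 by omega) (Int.natCast_nonneg S.n)
        omega
      obtain rfl | rfl | rfl : c = -1 ∨ c = 0 ∨ c = 1 := by omega
      · by_cases hj' : j + 1 < u
        · exact ⟨Sum.inr (Sum.inr ⟨j + 1, Finset.mem_Icc.mpr (by omega)⟩), by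
            simp only [f, Sum.elim_inr]; omega⟩
        · exact ⟨Sum.inr (Sum.inl ()), by simp only [f, Sum.elim_inr, Sum.elim_inl]; omega⟩
      · exact ⟨Sum.inl ⟨j + 1 - u, Finset.mem_Icc.mpr (by omega)⟩, by
          simp only [f, Sum.elim_inl]; omega⟩
      · exact ⟨Sum.inr (Sum.inl ()), by simp only [f, Sum.elim_inr, Sum.elim_inl]; omega⟩)
  obtain ⟨e'⟩ := P_equiv_V S
  exact ⟨e ≪≫ₗ piSumUnitEquivDirectSum _ ≪≫ₗ
    (LinearEquiv.refl _ _).prodCongr (e'.prodCongr (LinearEquiv.refl _ _))⟩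

/-- In $l=2(j+1-u)-nc$ the value $c=-2$ now gives the even $l$ and $c=-1$ the odd ones, up to $l=n$.
Since $2u>n$, the subtraction in $2u+2j-n$ never truncates. -/
theorem tens_decomposition_of_ge (hu : (S.n + 1) / 2 ≤ u) (hu' : u ≤ S.n - 1) :
    Nonempty (Tens S (VV S t r) (VV S t' r') ≃ₗ[H S]
      (⨁ j : Finset.Icc (S.n + 1 - u) ((S.n - 1) / 2), P S (2 * j)) ×
        (⨁ j : Finset.Icc 0 (S.n - u), P S (2 * u + 2 * j - S.n))) := by
  obtain ⟨h, hn⟩ := S.n_odd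
  let f : Finset.Icc (S.n + 1 - u) ((S.n - 1) / 2) ⊕ Finset.Icc 0 (S.n - u) → ℕ :=
    Sum.elim (fun j => 2 * j) fun j => 2 * u + 2 * j - S.n
  have hinj : Function.Injective f := by
    rintro (⟨a, ha⟩ | ⟨a, ha⟩) (⟨b, hb⟩ | ⟨b, hb⟩) hab <;>
      (try have ha' := Finset.mem_Icc.mp ha) <;> (try have hb' := Finset.mem_Icc.mp hb) <;>
      simp only [f, Sum.elim_inl, Sum.elim_inr, Sum.inl.injEq, Sum.inr.injEq,
        Subtype.mk.injEq, reduceCtorEq] at hab ⊢ <;> omega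
  have hle : ∀ i, f i ≤ S.n := by
    rintro (⟨a, ha⟩ | ⟨a, ha⟩) <;>
      (try have ha' := Finset.mem_Icc.mp ha) <;>
      simp only [f, Sum.elim_inl, Sum.elim_inr] <;> omega
  obtain ⟨e⟩ := tens_nonempty_equiv_pi ht ht' htt' hr hinj hle (fun l hl1 hl => by
    constructor
    · rintro ⟨⟨a, ha⟩ | ⟨a, ha⟩, rfl⟩ <;>
        (try have ha' := Finset.mem_Icc.mp ha) <;>
        simp only [f, Sum.elim_inl, Sum.elim_inr] at hl1 hl ⊢
      · exact ⟨a + u - S.n - 1, by omega, -2, by omega⟩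
      · exact ⟨2 * u + a - S.n - 1, by omega, -1, by omega⟩
    · rintro ⟨j, hj, c, hc⟩
      -- For $c\ge0$ the inequality $j<l$ would require $j\ge 2u-1\ge n$.
      have h1 : c < 0 := by
        by_contra h0
        have := mul_le_mul_of_nonneg_left (show 0 ≤ c by omega) (Int.natCast_nonneg S.n)
        omega
      have h2 : -3 < c := by
        by_contra h0
        have := mul_le_mul_of_nonneg_left (show c ≤ -3 by omega) (Int.natCast_nonneg S.n)
        omega
      obtain rfl | rfl : c = -2 ∨ c = -1 := by omega
      · exact ⟨Sum.inl ⟨j + 1 + S.n - u, Finset.mem_Icc.mpr (by omega)⟩, by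
          simp only [f, Sum.elim_inl]; omega⟩
      · exact ⟨Sum.inr ⟨j + 1 + S.n - 2 * u, Finset.mem_Icc.mpr (by omega)⟩, by
          simp only [f, Sum.elim_inr]; omega⟩)
  exact ⟨e ≪≫ₗ piSumEquivDirectSum _⟩

end decomposition

end SmallQuasi
end

open SmallQuasi in
theorem theorem5p4p11 {k : Type*} [Field k] [IsAlgClosed k] [CharZero k] (S : Datum k)
    (t t' : ℕ) (ht : 1 ≤ t ∧ t ≤ S.n - 1) (ht' : 1 ≤ t' ∧ t' ≤ S.n - 1) (htt' : t + t' = S.n)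
    (r r' : ℤ) (u : ℕ) (hu : u ≤ S.n - 1) (hr : r + r' ≡ (u : ℤ) [ZMOD (S.n : ℤ)]) :
    (u ≤ (S.n - 1) / 2 →
      Nonempty (Tens S (VV S t r) (VV S t' r') ≃ₗ[H S]
        (⨁ j : Finset.Icc u ((S.n - 1) / 2), P S (2 * j)) × V S S.n ×
          (⨁ j : Finset.Icc 1 (u - 1), P S (S.n - 2 * u + 2 * j)))) ∧
    ((S.n + 1) / 2 ≤ u →
      Nonempty (Tens S (VV S t r) (VV S t' r') ≃ₗ[H S]
        (⨁ j : Finset.Icc (S.n + 1 - u) ((S.n - 1) / 2), P S (2 * j)) ×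
          (⨁ j : Finset.Icc 0 (S.n - u), P S (2 * u + 2 * j - S.n)))) ∧
    (∀ l ≤ S.n, Module.Projective (H S) (P S l)) ∧
    (∀ l ≤ S.n, ∀ l' ≤ S.n, Nonempty (P S l ≃ₗ[H S] P S l') → l = l') ∧
    Nonempty (P S S.n ≃ₗ[H S] V S S.n) ∧ Subsingleton (P S 0) := by
  have h2 := S.two_lt
  exact ⟨tens_decomposition_of_le S ht'.1 (by omega) htt' hr,
    fun h => tens_decomposition_of_ge S ht'.1 (by omega) htt' hr h hu,
    fun l _ => (projCoverMap_isProjectiveCover (H S) (V S l)).projective,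
    fun l hl l' hl' h => eq_of_P_equiv S hl hl' h, P_equiv_V S, P_zero_subsingleton S⟩
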